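/- A graph $G=(V,E)$ here is undirected and loopless, multiple edges are allowed, and $V$ and $E$ may be infinite of any cardinality. For vertices $v,w$ let $E(v)$ be the set of edges containing $v$ and $E(v,w)$ the set of edges connecting $v$ to $w$; let $d_G(v)=|E(v)|$ (so multiple edges are counted with multiplicity) and $\mu(G)=\sup\{|E(v,w)| : v,w\in V\}$, both taken as (possibly infinite) cardinals. For a cardinal $\kappa$ and $X\subseteq V$, a $\kappa$-good coloring of $E$ over $X$ is a partial function $c$ from $E$ to the ordinals such that for every $x\in X$ with $d_G(x)\ge\kappa$, every ordinal $i<\kappa$ is a value of $c$ on $E(x)$, that is, $\kappa\subseteq c[E(x)]$. **Theorem.** Let $1\le n<\omega$, let $G=(V,E)$ be a graph, and let $X\subseteq V$ be such that $d_G(x)\ge n+\mu(G)$ for every $x\in X$. Then $E$ has an $n$-good coloring over $X$. -/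

import Mathlib

namespace Graph

universe u v

variable {α : Type u} {β : Type v}

/-- `d_G(x) = |E(x)|`, the number of edges containing `x`, as a cardinal. Parallel edges are
different elements of the edge type, so they are counted with multiplicity. (Only used for
graphs without loops.) -/
noncomputable def cardDegree (G : Graph α β) (x : α) : Cardinal.{v} :=
  Cardinal.mk (G.incidenceSet x)

/-- `E(x, y)`, the set of edges connecting `x` to `y`. -/
def edgesBetween (G : Graph α β) (x y : α) : Set β := {e | G.IsLink e x y}

/-- `|E(x, y)| ≤ |β|`, so the family of edge multiplicities has a genuine supremum. -/
theorem bddAbove_range_edgesBetween (G : Graph α β) :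
    BddAbove (Set.range fun p : α × α => Cardinal.mk (G.edgesBetween p.1 p.2)) :=
  ⟨Cardinal.mk β, by rintro _ ⟨p, rfl⟩; exact Cardinal.mk_set_le _⟩

/-- `μ(G)`, the supremum of the edge multiplicities `|E(x, y)|`, as a cardinal. -/
noncomputable def multiplicity (G : Graph α β) : Cardinal.{v} :=
  ⨆ p : α × α, Cardinal.mk (G.edgesBetween p.1 p.2)

/-- The partial function `c` from the edges of `G` to the ordinals is a `κ`-good coloring over `X`:
for every `x ∈ X` of degree at least `κ`, each color `i < κ` (`κ` viewed as an initial ordinal)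
is the color of some edge containing `x`. -/
def IsGoodColoringOver (G : Graph α β) (κ : Cardinal.{v}) (c : G.edgeSet →. Ordinal.{v})
    (X : Set α) : Prop :=
  ∀ x ∈ X, κ ≤ G.cardDegree x → ∀ i < κ.ord, ∃ e : G.edgeSet, G.Inc e x ∧ i ∈ c e

end Graph

/-!
Gupta's theorem is first reduced to finite graphs. If the multiplicity is infinite, then so are
the degrees on `X`, and Hall's theorem assigns to each vertex of `X` its own `n` edges
(`exists_coloring_of_two_mul_card_le`). If it is a natural number `μ`, then `n + μ` edges are kept
at each `x ∈ X`, and by compactness it is enough to treat finitely many vertices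
(`exists_coloring`). So the data are finite sets `A x` of edges with at least `n + μ` elements
each, two of which share at most `μ` edges, such that no edge lies in three of them.

Each vertex `x` is made to choose, for each color, at most one edge of `A x` with that color
(`IsPartialChoice`); the other edges at `x` are *spare*, and they may be recolored without harm to
`x`. In a subgraph of two colors every vertex makes at most two choices, so the components are
paths and cycles (`not_three_free`), and exchanging the colors in a component is harmless. Take a
choice with as few missing colors as possible, and suppose that `u` misses the color `a`. A spare
edge at `u` must be chosen by its other end, as otherwise it could get the color `a`. Exchanges
then show that spare edges at `u` have distinct colors (`IsOptimal.spareTo_unique`), and that if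
`e = uv` is spare at `u`, then no color is shared between the spare edges at `u` and those at `v`
(`IsOptimal.not_spareTo_of_spareTo`).

The contradiction comes from a fan in the style of Vizing's theorem, in which spare edges play the
part of missing colors. It starts at the other end of an edge that is spare at `u`. If a spare
edge at a vertex of the fan has color `c`, the fan is continued to the other end of the edge that
`u` chose with color `c`. The key step (`IsOptimal.exists_spareTo_shift`) shows that the color of
a spare edge at `u` can be shifted along the fan, so each vertex of the fan can be put in the
place of the first one (`IsOptimal.fan_spareTo`). Hence the fan never gets stuck, and, because `u`
has at least `μ + 1 ≥ 2` spare edges, all spare edges at its vertices have different colors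
(`IsOptimal.fan_spareTo_unique`). These edges number at least `μ` per vertex, and each of their
colors gives a chosen edge from `u` to the fan; with the spare edge that starts the fan, these are
more than `μ` edges per vertex of the fan, against the bound on multiplicities
(`IsOptimal.forall_ne_none`).
-/

namespace SpareColoring

open Finset

/-! ### Partial choices and their two-colored components -/

section

variable {V E ι : Type*}

/-- A partial choice, for each vertex `x` and color `c`, of an edge `f x c` of color `c` at `x`.
The set `A x` holds the edges available at `x`. An edge chosen at several vertices
is chosen with the same color everywhere, so `f` induces a partial coloring of the edges. -/
structure IsPartialChoice (A : V → Finset E) (f : V → ι → Option E) : Prop where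
  mem : ∀ {x c e}, f x c = some e → e ∈ A x
  color_unique : ∀ {x y c d e}, f x c = some e → f y d = some e → c = d

/-- The edge `e` is available at `x`, but it is not chosen there. -/
def Spare (A : V → Finset E) (f : V → ι → Option E) (x : V) (e : E) : Prop :=
  e ∈ A x ∧ ∀ c, f x c ≠ some e

/-- The edge `e` is spare at `x`, and it is chosen with color `c` at its other end `y`. -/
def SpareTo (A : V → Finset E) (f : V → ι → Option E) (x : V) (e : E) (y : V) (c : ι) : Prop :=
  Spare A f x e ∧ f y c = some e

/-- No edge is available at three vertices. -/
def AtMostTwoEnds (A : V → Finset E) : Prop :=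
  ∀ {e x y z}, e ∈ A x → e ∈ A y → e ∈ A z → x ≠ y → x ≠ z → y = z

/-- The edge chosen at `x` with color `c`, if any, is not chosen at another vertex. -/
def Free (f : V → ι → Option E) (x : V) (c : ι) : Prop :=
  ∀ e y, f x c = some e → f y c = some e → y = x

/-- Two vertices are adjacent if they share a chosen edge of color `a` or `b`. -/
def kempeGraph (f : V → ι → Option E) (a b : ι) : SimpleGraph V where
  Adj x y := x ≠ y ∧ ∃ c, (c = a ∨ c = b) ∧ ∃ e, f x c = some e ∧ f y c = some e
  symm := ⟨fun _ _ ⟨h, c, hc, e, h1, h2⟩ => ⟨h.symm, c, hc, e, h2, h1⟩⟩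
  loopless := ⟨fun _ h => h.1 rfl⟩

/-- The vertex set `P` is a union of components of `kempeGraph f a b`. -/
def IsKempeClosed (f : V → ι → Option E) (a b : ι) (P : Set V) : Prop :=
  ∀ x ∈ P, ∀ y c e, (c = a ∨ c = b) → f x c = some e → f y c = some e → y ∈ P

/-- The component of `x` in `kempeGraph f a b`. -/
def component (f : V → ι → Option E) (a b : ι) (x : V) : Set V :=
  {y | (kempeGraph f a b).Reachable x y}

theorem isKempeClosed_component (f : V → ι → Option E) (a b : ι) (x : V) :
    IsKempeClosed f a b (component f a b x) := by
  intro y hy z c e hc h1 h2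
  by_cases hyz : y = z
  · exact hyz ▸ hy
  · exact SimpleGraph.Reachable.trans hy (SimpleGraph.Adj.reachable ⟨hyz, c, hc, e, h1, h2⟩)

theorem mem_component_self (f : V → ι → Option E) (a b : ι) (x : V) :
    x ∈ component f a b x := SimpleGraph.Reachable.refl x

/-- A component lies in every closed set that meets it. -/
theorem component_subset {f : V → ι → Option E} {a b : ι} {x : V} {P : Set V}
    (hP : IsKempeClosed f a b P) (hx : x ∈ P) : component f a b x ⊆ P := by
  rintro y ⟨p⟩
  induction p with
  | nil => exact hx
  | cons h p ih =>
    obtain ⟨-, c, hc, e, h1, h2⟩ := h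
    exact ih (hP _ hx _ c e hc h1 h2)

theorem component_eq {f : V → ι → Option E} {a b : ι} {x y : V}
    (h : y ∈ component f a b x) : component f a b y = component f a b x :=
  Set.ext fun _ => ⟨fun hz => SimpleGraph.Reachable.trans h hz,
    fun hz => SimpleGraph.Reachable.trans (SimpleGraph.Reachable.symm h) hz⟩

theorem mem_component_symm {f : V → ι → Option E} {a b : ι} {x y : V}
    (h : y ∈ component f a b x) : x ∈ component f a b y :=
  SimpleGraph.Reachable.symm h

variable {A : V → Finset E} {f : V → ι → Option E}

theorem SpareTo.ne {x e y c} (h : SpareTo A f x e y c) : y ≠ x := by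
  rintro rfl
  exact h.1.2 _ h.2

theorem SpareTo.free {x e y c} (hA : AtMostTwoEnds A) (hf : IsPartialChoice A f)
    (h : SpareTo A f x e y c) : Free f y c := by
  intro e' z h1 h2
  obtain rfl : e = e' := by simpa [h.2] using h1
  by_contra hzy
  exact h.1.2 c ((hA (hf.mem h2) (hf.mem h.2) h.1.1 hzy (by
    rintro rfl; exact h.1.2 _ h2)) ▸ h.2)

theorem free_of_none {x : V} {c : ι} (h : f x c = none) : Free f x c := by
  intro e y h1
  simp [h] at h1

/-- A component of `kempeGraph f a b` is a path or a cycle, so at most two of its choices are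
free: the count is of pairs `(x, c)` of a vertex and a color, not of vertices. -/
theorem not_three_free [Finite V] (hA : AtMostTwoEnds A) (hf : IsPartialChoice A f) {a b : ι}
    {x y z : V} {c₁ c₂ c₃ : ι} (hx : Free f x c₁) (hy : Free f y c₂) (hz : Free f z c₃)
    (h₁ : c₁ = a ∨ c₁ = b) (h₂ : c₂ = a ∨ c₂ = b) (h₃ : c₃ = a ∨ c₃ = b)
    (hxy : (x, c₁) ≠ (y, c₂)) (hxz : (x, c₁) ≠ (z, c₃)) (hyz : (y, c₂) ≠ (z, c₃))
    (hyx : y ∈ component f a b x) (hzx : z ∈ component f a b x) : False := by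
  classical
  cases nonempty_fintype V
  set G := kempeGraph f a b with hG
  set C := G.connectedComponentMk x with hC
  have hmem : ∀ w, w ∈ component f a b x → w ∈ C := fun w hw =>
    (SimpleGraph.ConnectedComponent.mem_supp_iff _ _).2
      (SimpleGraph.ConnectedComponent.sound (SimpleGraph.Reachable.symm hw))
  have hconn := C.connected_toSimpleGraph
  have hcard := hconn.card_vert_le_card_edgeSet_add_one
  set H := C.toSimpleGraph with hH
  have hdart := H.dart_card_eq_twice_card_edges
  have hadj : ∀ d : H.Dart, G.Adj d.fst.1 d.snd.1 := fun d => d.adj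
  choose hne col hcol ed hed1 hed2 using hadj
  let S : Finset (C × ι) := univ ×ˢ {a, b}
  let T : Finset (C × ι) := {(⟨x, hmem x (mem_component_self _ _ _ _)⟩, c₁),
    (⟨y, hmem y hyx⟩, c₂), (⟨z, hmem z hzx⟩, c₃)}
  have hTS : T ⊆ S := by
    intro p hp
    simp only [T, mem_insert, mem_singleton] at hp
    simp only [S, mem_product, mem_univ, true_and, mem_insert, mem_singleton]
    rcases hp with rfl | rfl | rfl <;> assumption
  have hT : #T = 3 := by
    apply card_eq_three.2
    exact ⟨_, _, _, by simpa using hxy, by simpa using hxz, by simpa using hyz, rfl⟩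
  have hinj : #(univ : Finset H.Dart) ≤ #(S \ T) := by
    refine card_le_card_of_injOn (fun d => (d.fst, col d)) ?_ ?_
    · intro d _
      simp only [coe_sdiff, Set.mem_sdiff, mem_coe]
      refine ⟨by simpa [S] using hcol d, ?_⟩
      have key : ∀ w c, Free f w c → ¬ (d.fst.1 = w ∧ col d = c) := by
        rintro _ _ h ⟨rfl, rfl⟩
        exact hne d (h _ _ (hed1 d) (hed2 d)).symm
      simp only [T, mem_insert, mem_singleton, Prod.mk.injEq, Subtype.ext_iff]
      rintro (h | h | h)
      · exact key _ _ hx h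
      · exact key _ _ hy h
      · exact key _ _ hz h
    · intro d _ d' _ h
      simp only [Prod.mk.injEq] at h
      have he : ed d = ed d' := by
        have := hed1 d
        rw [h.1, h.2, hed1 d'] at this
        simpa using this.symm
      have hs : d.snd = d'.snd := by
        apply Subtype.ext
        refine hA (hf.mem (hed1 d)) (hf.mem (hed2 d)) (he ▸ hf.mem (hed2 d')) (hne d) ?_
        rw [h.1]
        exact hne d'
      exact SimpleGraph.Dart.ext _ _ (Prod.ext h.1 hs)
  rw [card_sdiff_of_subset hTS, hT, card_univ, hdart] at hinj
  have hS : #S ≤ Fintype.card C * 2 := by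
    rw [card_product, card_univ]
    exact Nat.mul_le_mul_left _ card_le_two
  rw [Nat.card_eq_fintype_card, Nat.card_eq_fintype_card, ← SimpleGraph.edgeFinset_card] at hcard
  have h3 : 3 ≤ #S := hT ▸ card_le_card hTS
  omega

end

/-! ### Optimal choices, exchanges and moves of the defect -/

section

variable {V E ι : Type*} {A : V → Finset E} {f g : V → ι → Option E}

/-- The pairs `(x, c)` such that `x` has an edge of color `c`. -/
def filled (f : V → ι → Option E) : Set (V × ι) := {p | f p.1 p.2 ≠ none}

/-- A partial choice with as many filled pairs as possible. -/
def IsOptimal (A : V → Finset E) (f : V → ι → Option E) : Prop :=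
  IsPartialChoice A f ∧ ∀ g : V → ι → Option E, IsPartialChoice A g →
    (filled g).ncard ≤ (filled f).ncard

theorem IsOptimal.of_le (hf : IsOptimal A f) (hg : IsPartialChoice A g)
    (h : (filled f).ncard ≤ (filled g).ncard) : IsOptimal A g :=
  ⟨hg, fun k hk => (hf.2 k hk).trans h⟩

open Classical in
/-- Replace the choice at `x` for the color `c` by `o`. -/
noncomputable def reassign (f : V → ι → Option E) (x : V) (c : ι) (o : Option E) :
    V → ι → Option E :=
  fun y d => if y = x ∧ d = c then o else f y d

@[simp] theorem reassign_self (x : V) (c : ι) (o : Option E) : reassign f x c o x c = o := by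
  simp [reassign]

theorem reassign_of_ne {x y : V} {c d : ι} {o : Option E} (h : ¬ (y = x ∧ d = c)) :
    reassign f x c o y d = f y d := by
  simp [reassign, h]

theorem reassign_of_vertex_ne {x y : V} {c d : ι} {o : Option E} (h : y ≠ x) :
    reassign f x c o y d = f y d := reassign_of_ne (by tauto)

theorem reassign_of_color_ne {x y : V} {c d : ι} {o : Option E} (h : d ≠ c) :
    reassign f x c o y d = f y d := reassign_of_ne (by tauto)

theorem IsPartialChoice.reassign_some (hf : IsPartialChoice A f) {x : V} {c : ι} {e : E}
    (he : e ∈ A x) (hcol : ∀ y d, f y d = some e → d = c) :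
    IsPartialChoice A (reassign f x c (some e)) where
  mem {y d e'} h := by
    by_cases hyd : y = x ∧ d = c
    · obtain ⟨rfl, rfl⟩ := hyd
      simp only [reassign_self, Option.some.injEq] at h
      exact h ▸ he
    · exact hf.mem (by rwa [reassign_of_ne hyd] at h)
  color_unique {y z d d' e'} h h' := by
    by_cases hyd : y = x ∧ d = c <;> by_cases hzd : z = x ∧ d' = c
    · rw [hyd.2, hzd.2]
    · obtain ⟨rfl, rfl⟩ := hyd
      simp only [reassign_self, Option.some.injEq] at h
      rw [reassign_of_ne hzd, ← h] at h'
      exact (hcol _ _ h').symm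
    · obtain ⟨rfl, rfl⟩ := hzd
      simp only [reassign_self, Option.some.injEq] at h'
      rw [reassign_of_ne hyd, ← h'] at h
      exact hcol _ _ h
    · rw [reassign_of_ne hyd] at h
      rw [reassign_of_ne hzd] at h'
      exact hf.color_unique h h'

theorem IsPartialChoice.reassign_none (hf : IsPartialChoice A f) (x : V) (c : ι) :
    IsPartialChoice A (reassign f x c none) := by
  have key : ∀ {y d e}, reassign f x c none y d = some e → f y d = some e := by
    intro y d e h
    by_cases hyd : y = x ∧ d = c
    · obtain ⟨rfl, rfl⟩ := hyd
      simp at h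
    · rwa [reassign_of_ne hyd] at h
  exact ⟨fun h => hf.mem (key h), fun h h' => hf.color_unique (key h) (key h')⟩

theorem filled_reassign_some (x : V) (c : ι) (e : E) :
    filled (reassign f x c (some e)) = insert (x, c) (filled f) := by
  ext ⟨y, d⟩
  by_cases hyd : y = x ∧ d = c
  · obtain ⟨rfl, rfl⟩ := hyd
    simp [filled]
  · simp [filled, reassign_of_ne hyd, hyd]

theorem filled_reassign_none (x : V) (c : ι) :
    filled (reassign f x c none) = filled f \ {(x, c)} := by
  ext ⟨y, d⟩
  by_cases hyd : y = x ∧ d = c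
  · obtain ⟨rfl, rfl⟩ := hyd
    simp [filled]
  · simp [filled, reassign_of_ne hyd, hyd]

theorem spare_reassign_of_ne {x z : V} {c : ι} {o : Option E} {h : E} (hx : x ≠ z) :
    Spare A (reassign f z c o) x h ↔ Spare A f x h := by
  simp only [Spare, reassign_of_vertex_ne hx]

theorem spare_reassign_some {x : V} {c : ι} {e e' : E} (h : Spare A f x e') (hne : e' ≠ e) :
    Spare A (reassign f x c (some e)) x e' := by
  refine ⟨h.1, fun d hd => ?_⟩
  by_cases hdc : d = c
  · subst hdc
    rw [reassign_self] at hd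
    exact hne (by simpa using hd.symm)
  · rw [reassign_of_color_ne hdc] at hd
    exact h.2 _ hd

open Classical in
/-- Exchange the colors `a` and `b` at the vertices of `P`. -/
noncomputable def kempeSwap (f : V → ι → Option E) (a b : ι) (P : Set V) : V → ι → Option E :=
  fun x c => if x ∈ P then f x (Equiv.swap a b c) else f x c

theorem kempeSwap_of_notMem {a b : ι} {P : Set V} {x : V} (h : x ∉ P) (c : ι) :
    kempeSwap f a b P x c = f x c := by
  simp [kempeSwap, h]

open Classical in
theorem kempeSwap_of_ne {a b : ι} {P : Set V} {c : ι} (ha : c ≠ a) (hb : c ≠ b) (x : V) :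
    kempeSwap f a b P x c = f x c := by
  simp [kempeSwap, Equiv.swap_apply_of_ne_of_ne ha hb]

theorem kempeSwap_left {a b : ι} {P : Set V} {x : V} (h : x ∈ P) :
    kempeSwap f a b P x a = f x b := by
  simp [kempeSwap, h]

theorem kempeSwap_right {a b : ι} {P : Set V} {x : V} (h : x ∈ P) :
    kempeSwap f a b P x b = f x a := by
  simp [kempeSwap, h]

open Classical in
theorem spare_kempeSwap {a b : ι} {P : Set V} {x : V} {e : E} :
    Spare A (kempeSwap f a b P) x e ↔ Spare A f x e := by
  refine and_congr_right fun _ => ?_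
  by_cases h : x ∈ P
  · simp only [kempeSwap, h, if_true]
    exact (Equiv.swap a b).forall_congr_right (q := fun c => f x c ≠ some e)
  · simp [kempeSwap, h]

protected theorem SpareTo.kempeSwap_of_notMem {x w : V} {g : E} {b c d : ι} {P : Set V}
    (h : SpareTo A f x g w d)
    (hw : w ∉ P) : SpareTo A (kempeSwap f b c P) x g w d :=
  ⟨spare_kempeSwap.2 h.1, (kempeSwap_of_notMem hw d).trans h.2⟩

protected theorem SpareTo.kempeSwap_of_ne {x w : V} {g : E} {b c d : ι} {P : Set V}
    (h : SpareTo A f x g w d)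
    (hb : d ≠ b) (hc : d ≠ c) : SpareTo A (kempeSwap f b c P) x g w d :=
  ⟨spare_kempeSwap.2 h.1, (kempeSwap_of_ne hb hc w).trans h.2⟩

open Classical in
protected theorem IsPartialChoice.kempeSwap (hf : IsPartialChoice A f) {a b : ι} {P : Set V}
    (hP : IsKempeClosed f a b P) : IsPartialChoice A (kempeSwap f a b P) where
  mem {x c e} h := by
    unfold kempeSwap at h
    split_ifs at h <;> exact hf.mem h
  color_unique {x y c d e} h h' := by
    have key : ∀ {x y c d}, x ∈ P → y ∉ P → f x (Equiv.swap a b c) = some e →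
        f y d = some e → c = d := by
      intro x y c d hx hy h h'
      have h1 := hf.color_unique h h'
      by_cases hd : d = a ∨ d = b
      · exact (hy (hP x hx y d e hd (h1 ▸ h) h')).elim
      · push Not at hd
        rw [← Equiv.swap_apply_of_ne_of_ne hd.1 hd.2] at h1
        exact (Equiv.swap a b).injective h1
    unfold kempeSwap at h h'
    split_ifs at h h' with hx hy hy
    · exact (Equiv.swap a b).injective (hf.color_unique h h')
    · exact key hx hy h h'
    · exact (key hy hx h' h).symm
    · exact hf.color_unique h h'

theorem ncard_filled_kempeSwap (a b : ι) (P : Set V) :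
    (filled (kempeSwap f a b P)).ncard = (filled f).ncard := by
  classical
  let σ : V × ι ≃ V × ι := Equiv.prodShear (Equiv.refl V)
    (fun x => if x ∈ P then Equiv.swap a b else Equiv.refl ι)
  have : filled (kempeSwap f a b P) = σ ⁻¹' filled f := by
    ext ⟨x, c⟩
    by_cases hx : x ∈ P <;> simp [filled, kempeSwap, σ, hx]
  rw [this, ← Set.ncard_image_of_injective _ σ.injective, Set.image_preimage_eq _ σ.surjective]

protected theorem IsOptimal.kempeSwap (hf : IsOptimal A f) {a b : ι} {P : Set V}
    (hP : IsKempeClosed f a b P) : IsOptimal A (kempeSwap f a b P) :=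
  hf.of_le (hf.1.kempeSwap hP) (ncard_filled_kempeSwap a b P).ge

variable [Finite V] [Finite ι]

/-- If an edge could be chosen at `x` for a missing color, the choice would not be optimal. -/
theorem IsOptimal.exists_of_none (hf : IsOptimal A f) {x : V} {c : ι} (hx : f x c = none) {e : E}
    (he : e ∈ A x) : ∃ y d, d ≠ c ∧ f y d = some e := by
  by_contra! h
  have h1 := hf.1.reassign_some he fun y d hyd => by_contra fun hd => h y d hd hyd
  have h2 := hf.2 _ h1
  rw [filled_reassign_some, Set.ncard_insert_of_notMem (by simp [filled, hx])] at h2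
  omega

theorem IsOptimal.exists_spareTo (hf : IsOptimal A f) {x : V} {c : ι} (hx : f x c = none) {e : E}
    (he : Spare A f x e) : ∃ y d, SpareTo A f x e y d := by
  obtain ⟨y, d, -, h⟩ := hf.exists_of_none hx he.1
  exact ⟨y, d, he, h⟩

theorem IsOptimal.ne_none (hf : IsOptimal A f) {x : V} {c : ι} {e : E} (he : e ∈ A x) {y : V}
    (h : f y c = some e) : f x c ≠ none := by
  intro hx
  obtain ⟨z, d, hd, h'⟩ := hf.exists_of_none hx he
  exact hd (hf.1.color_unique h' h)

/-- A chosen edge may be exchanged for a spare edge of the same color. -/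
theorem IsOptimal.reassign_spareTo (hf : IsOptimal A f) {x y : V} {c : ι} {e : E}
    (h : SpareTo A f x e y c) : IsOptimal A (reassign f x c (some e)) := by
  refine hf.of_le (hf.1.reassign_some h.1.1 fun z d hz => hf.1.color_unique hz h.2) ?_
  rw [filled_reassign_some]
  exact Set.ncard_le_ncard (Set.subset_insert _ _)

/-- At a vertex that misses a color, an edge given up for a spare edge of the same color
is chosen at its other end. -/
theorem IsOptimal.exists_spareTo_reassign (hf : IsOptimal A f) {u y : V} {a c : ι} {e k : E}
    (hu : f u a = none) (h : SpareTo A f u e y c) (hk : f u c = some k) :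
    ∃ z, SpareTo A (reassign f u c (some e)) u k z c ∧ f z c = some k := by
  have hac : a ≠ c := by
    rintro rfl
    simp [hu] at hk
  have hspare : Spare A (reassign f u c (some e)) u k := by
    refine ⟨hf.1.mem hk, fun d hd => ?_⟩
    by_cases hdc : d = c
    · subst hdc
      rw [reassign_self] at hd
      obtain rfl : e = k := by simpa using hd
      exact h.1.2 _ hk
    · rw [reassign_of_color_ne hdc] at hd
      exact hdc (hf.1.color_unique hd hk)
  obtain ⟨z, d, hz⟩ := (hf.reassign_spareTo h).exists_spareTo
    (by rw [reassign_of_color_ne hac, hu]) hspare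
  have hfz := hz.2
  rw [reassign_of_vertex_ne hz.ne] at hfz
  obtain rfl := hf.1.color_unique hfz hk
  exact ⟨z, hz, hfz⟩

/-- If `c` is missing at `x` and `e` is spare at `x`, then choosing `e` at `x` with color `c`
moves the defect to the other end of `e`. -/
theorem IsOptimal.move (hA : AtMostTwoEnds A) (hf : IsOptimal A f) {x y : V} {c d : ι} {e : E}
    (hx : f x c = none) (h : SpareTo A f x e y d) :
    IsOptimal A (reassign (reassign f y d none) x c (some e)) := by
  have hne := h.ne
  refine hf.of_le ((hf.1.reassign_none y d).reassign_some h.1.1 ?_) ?_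
  · intro z d' hz
    exfalso
    by_cases hzy : z = y ∧ d' = d
    · obtain ⟨rfl, rfl⟩ := hzy
      simp at hz
    rw [reassign_of_ne hzy] at hz
    have hzx : z ≠ x := by rintro rfl; exact h.1.2 _ hz
    obtain rfl := hA h.1.1 (hf.1.mem h.2) (hf.1.mem hz) hne.symm hzx.symm
    exact hzy ⟨rfl, hf.1.color_unique hz h.2⟩
  · rw [filled_reassign_some, filled_reassign_none,
      Set.ncard_insert_of_notMem (by simp [filled, hx]),
      Set.ncard_sdiff_singleton_add_one (by simp [filled, h.2])]

/-- If color `a` is missing at `u`, then a spare edge of color `b` at `u` leads to a vertex in the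
same `a`-`b` component. -/
theorem IsOptimal.mem_component (hf : IsOptimal A f) {u v : V} {a b : ι} {e : E}
    (hu : f u a = none) (h : SpareTo A f u e v b) : v ∈ component f a b u := by
  by_contra hv
  have hu' : u ∉ component f a b v := fun h => hv (mem_component_symm h)
  have hopt := hf.kempeSwap (isKempeClosed_component f a b v)
  exact hopt.ne_none h.1.1 ((kempeSwap_left (mem_component_self f a b v)).trans h.2)
    ((kempeSwap_of_notMem hu' a).trans hu)

/-- At a vertex that misses a color, spare edges have distinct colors. -/
theorem IsOptimal.spareTo_unique (hA : AtMostTwoEnds A) (hf : IsOptimal A f) {u v w : V} {a b : ι}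
    {e e' : E} (hu : f u a = none) (h : SpareTo A f u e v b) (h' : SpareTo A f u e' w b) :
    e = e' := by
  by_contra hne
  have hab : a ≠ b := by
    rintro rfl
    exact hf.ne_none h.1.1 h.2 hu
  refine not_three_free hA hf.1 (free_of_none hu) (h.free hA hf.1) (h'.free hA hf.1)
    (Or.inl rfl) (Or.inr rfl) (Or.inr rfl) (by simp [hab]) (by simp [hab]) ?_
    (hf.mem_component hu h) (hf.mem_component hu h')
  intro hvw
  have hvw : v = w := by simpa using hvw
  subst hvw
  exact hne (by simpa [h.2] using h'.2)

/-- Let `u` miss the color `a`, and let `e = uv` be spare at `u` with color `b`. A spare edge at `v`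
has a color other than `a` and `b`. -/
theorem IsOptimal.exists_spareTo_of_spareTo (hA : AtMostTwoEnds A) (hf : IsOptimal A f) {u v : V}
    {a b : ι} {e g : E} (hu : f u a = none) (h : SpareTo A f u e v b) (hg : Spare A f v g) :
    ∃ w c, SpareTo A f v g w c ∧ c ≠ a ∧ c ≠ b := by
  have hne := h.ne
  have hge : g ≠ e := by
    rintro rfl
    exact hg.2 _ h.2
  have hopt := hf.move hA hu h
  set f' := reassign (reassign f v b none) u a (some e) with hf'
  have hv : ∀ c, f' v c = reassign f v b none v c := fun c => reassign_of_vertex_ne hne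
  have hvb : f' v b = none := by rw [hv, reassign_self]
  have hspare : ∀ k, k ∈ A v → (∀ c ≠ b, f v c ≠ some k) → Spare A f' v k := by
    intro k hk h2
    refine ⟨hk, fun c => ?_⟩
    by_cases hc : c = b
    · subst hc
      simp [hvb]
    · rw [hv, reassign_of_color_ne hc]
      exact h2 c hc
  have hg' : Spare A f' v g := hspare g hg.1 fun c _ => hg.2 c
  obtain ⟨w, c, hcb, hw⟩ := hopt.exists_of_none hvb hg.1
  have hwv : w ≠ v := by
    rintro rfl
    exact hg'.2 _ hw
  have hwu : ¬ (w = u ∧ c = a) := by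
    rintro ⟨rfl, rfl⟩
    rw [hf', reassign_self] at hw
    exact hge (by simpa using hw.symm)
  have hw' : f w c = some g := by
    rwa [hf', reassign_of_ne hwu, reassign_of_vertex_ne hwv] at hw
  refine ⟨w, c, ⟨hg, hw'⟩, ?_, hcb⟩
  rintro rfl
  -- Otherwise `e` and `g` are spare edges of the same color at `v` once the defect is moved there.
  refine hge (hopt.spareTo_unique hA hvb ⟨hg', hw⟩ ⟨hspare e (hf.1.mem h.2) ?_, reassign_self ..⟩)
  intro d hd hd'
  exact hd (hf.1.color_unique hd' h.2)

theorem IsOptimal.color_ne (hA : AtMostTwoEnds A) (hf : IsOptimal A f) {u v w : V}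
    {a b c : ι} {e g : E} (hu : f u a = none) (h : SpareTo A f u e v b)
    (hg : SpareTo A f v g w c) : f u c ≠ none ∧ c ≠ b := by
  constructor
  · intro hc
    obtain ⟨w', c', h', h1, -⟩ := hf.exists_spareTo_of_spareTo hA hc h hg.1
    exact h1 (hf.1.color_unique h'.2 hg.2)
  · obtain ⟨w', c', h', -, h1⟩ := hf.exists_spareTo_of_spareTo hA hu h hg.1
    rwa [hf.1.color_unique hg.2 h'.2]

/-- Two consecutive spare edges `e = uv` and `g = vw` end in the same component for their
colors. -/
theorem IsOptimal.mem_component_of_spareTo (hA : AtMostTwoEnds A) (hf : IsOptimal A f) {u v w : V}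
    {a b c : ι} {e g : E} (hu : f u a = none) (h : SpareTo A f u e v b)
    (hg : SpareTo A f v g w c) : w ∈ component f b c v := by
  by_contra hw
  have hv' : v ∉ component f b c w := fun h => hw (mem_component_symm h)
  obtain ⟨hc, hcb⟩ := hf.color_ne hA hu h hg
  have hab : a ≠ b := by
    rintro rfl
    exact hf.ne_none h.1.1 h.2 hu
  have hac : a ≠ c := by
    rintro rfl
    exact hc hu
  have hopt := hf.kempeSwap (isKempeClosed_component f b c w)
  refine (hopt.color_ne hA (u := u) (a := a) (v := v) (b := b) (e := e) (w := w) (c := b) (g := g)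
    ?_ ?_ ?_).2 rfl
  · rw [kempeSwap_of_ne hab hac, hu]
  · exact ⟨spare_kempeSwap.2 h.1, by rw [kempeSwap_of_notMem hv', h.2]⟩
  · exact ⟨spare_kempeSwap.2 hg.1, by rw [kempeSwap_left (mem_component_self ..), hg.2]⟩

/-- Let `u` miss a color, and let `e = uv` be spare at `u`. No color occurs on spare edges of both
`u` and `v`. -/
theorem IsOptimal.not_spareTo_of_spareTo (hA : AtMostTwoEnds A) (hf : IsOptimal A f)
    {u v w v' : V} {a b c : ι} {e g e' : E} (hu : f u a = none) (h : SpareTo A f u e v b)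
    (hg : SpareTo A f v g w c) : ¬ SpareTo A f u e' v' c := by
  intro h'
  obtain ⟨hc, hcb⟩ := hf.color_ne hA hu h hg
  have hab : a ≠ b := by
    rintro rfl
    exact hf.ne_none h.1.1 h.2 hu
  have hac : a ≠ c := by
    rintro rfl
    exact hc hu
  have hv' : v' ∉ component f b c v := by
    intro hv'
    refine not_three_free hA hf.1 (h.free hA hf.1) (hg.free hA hf.1) (h'.free hA hf.1)
      (Or.inl rfl) (Or.inr rfl) (Or.inr rfl) (by simp [hcb.symm]) (by simp [hcb.symm]) ?_
      (hf.mem_component_of_spareTo hA hu h hg) hv'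
    intro hww
    have hww : w = v' := by simpa using hww
    subst hww
    obtain rfl : g = e' := by simpa [hg.2] using h'.2
    exact hg.ne (hA h'.1.1 hg.1.1 (hf.1.mem hg.2) h.ne.symm h'.ne.symm).symm
  have hopt := hf.kempeSwap (isKempeClosed_component f b c v)
  have hee' : e = e' := by
    refine hopt.spareTo_unique hA (u := u) (a := a) (v := v) (b := c) (w := v') ?_ ?_ ?_
    · rw [kempeSwap_of_ne hab hac, hu]
    · exact ⟨spare_kempeSwap.2 h.1, by rw [kempeSwap_right (mem_component_self ..), h.2]⟩
    · exact ⟨spare_kempeSwap.2 h'.1, by rw [kempeSwap_of_notMem hv', h'.2]⟩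
  subst hee'
  exact hcb (hf.1.color_unique h'.2 h.2)

/-- Let `u` miss a color. Two spare edges of different colors at `u` end in the same component for
their colors. -/
theorem IsOptimal.mem_component_of_spareTo_of_ne (hA : AtMostTwoEnds A) (hf : IsOptimal A f)
    {u v v' : V} {a b c : ι} {e e' : E} (hu : f u a = none) (h : SpareTo A f u e v b)
    (h' : SpareTo A f u e' v' c) (hbc : b ≠ c) : v' ∈ component f b c v := by
  by_contra hv'
  have hv : v ∉ component f b c v' := fun h => hv' (mem_component_symm h)
  have hab : a ≠ b := by
    rintro rfl
    exact hf.ne_none h.1.1 h.2 hu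
  have hac : a ≠ c := by
    rintro rfl
    exact hf.ne_none h'.1.1 h'.2 hu
  have hopt := hf.kempeSwap (isKempeClosed_component f b c v')
  have hee' : e = e' := by
    refine hopt.spareTo_unique hA (u := u) (a := a) (v := v) (b := b) (w := v') ?_ ?_ ?_
    · rw [kempeSwap_of_ne hab hac, hu]
    · exact ⟨spare_kempeSwap.2 h.1, by rw [kempeSwap_of_notMem hv, h.2]⟩
    · exact ⟨spare_kempeSwap.2 h'.1, by rw [kempeSwap_left (mem_component_self ..), h'.2]⟩
  subst hee'
  exact hbc (hf.1.color_unique h.2 h'.2)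

end

/-! ### Shifting the color of a spare edge -/

section

variable {V E ι : Type*} {A : V → Finset E} {f f' g : V → ι → Option E}

/-- Every edge that is spare at `x` for `f` is spare at `x` for `f'`, and it is chosen
at the same vertices with the same color. -/
def KeepsSpare (A : V → Finset E) (f f' : V → ι → Option E) (x : V) : Prop :=
  ∀ h, Spare A f x h → Spare A f' x h ∧ ∀ y d, f y d = some h ↔ f' y d = some h

theorem KeepsSpare.trans {x : V} (h₁ : KeepsSpare A f f' x) (h₂ : KeepsSpare A f' g x) :
    KeepsSpare A f g x := fun h hh =>
  ⟨(h₂ h (h₁ h hh).1).1, fun y d => ((h₁ h hh).2 y d).trans ((h₂ h (h₁ h hh).1).2 y d)⟩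

theorem KeepsSpare.spareTo {x y : V} {e : E} {d : ι} (h : KeepsSpare A f f' x)
    (he : SpareTo A f x e y d) : SpareTo A f' x e y d :=
  ⟨(h e he.1).1, ((h e he.1).2 y d).1 he.2⟩

theorem keepsSpare_reassign (hA : AtMostTwoEnds A) (hf : IsPartialChoice A f) {x y z : V} {c : ι}
    {k : E} (hk : SpareTo A f z k y c) (hz : ∀ h, f z c = some h → ∃ y, y ≠ z ∧ f y c = some h)
    (hx : x ≠ z) : KeepsSpare A f (reassign f z c (some k)) x := by
  intro h hh
  refine ⟨(spare_reassign_of_ne hx).2 hh, fun y' d => ?_⟩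
  by_cases hyd : y' = z ∧ d = c
  · obtain ⟨rfl, rfl⟩ := hyd
    rw [reassign_self]
    constructor
    · intro h1
      obtain ⟨y₀, hy₀, h2⟩ := hz h h1
      exact absurd h2 (hA (hf.mem h1) hh.1 (hf.mem h2) hx.symm hy₀.symm ▸ hh.2 d)
    · rintro h1
      obtain rfl : k = h := by simpa using h1
      exact absurd hk.2 (hA hk.1.1 hh.1 (hf.mem hk.2) hx.symm hk.ne.symm ▸ hh.2 d)
  · rw [reassign_of_ne hyd]

theorem keepsSpare_kempeSwap {x : V} {a b : ι} {P : Set V}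
    (hP : ∀ h y d, y ∈ P → (d = a ∨ d = b) → ¬ SpareTo A f x h y d) :
    KeepsSpare A f (kempeSwap f a b P) x := by
  intro h hh
  refine ⟨spare_kempeSwap.2 hh, fun y d => ?_⟩
  by_cases hy : y ∈ P
  · by_cases ha : d = a
    · subst ha
      rw [kempeSwap_left hy]
      exact iff_of_false (fun h' => hP h y _ hy (Or.inl rfl) ⟨hh, h'⟩)
        (fun h' => hP h y _ hy (Or.inr rfl) ⟨hh, h'⟩)
    · by_cases hb : d = b
      · subst hb
        rw [kempeSwap_right hy]
        exact iff_of_false (fun h' => hP h y _ hy (Or.inr rfl) ⟨hh, h'⟩)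
          (fun h' => hP h y _ hy (Or.inl rfl) ⟨hh, h'⟩)
      · rw [kempeSwap_of_ne ha hb]
  · rw [kempeSwap_of_notMem hy]

theorem Free.mono {x : V} {c : ι} (h : Free f x c)
    (hsub : ∀ y d k, f' y d = some k → f y d = some k) : Free f' x c :=
  fun k y h1 h2 => h k y (hsub _ _ _ h1) (hsub _ _ _ h2)

/-- If an edge is chosen at two vertices and one of these choices is dropped, then the other one
becomes free. -/
theorem free_of_partner_none (hA : AtMostTwoEnds A) (hf : IsPartialChoice A f) {x z : V}
    {c : ι} {k : E} (hsub : ∀ y d k, f' y d = some k → f y d = some k) (hx : f x c = some k)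
    (hz : f z c = some k) (hxz : x ≠ z) (hnone : f' z c = none) : Free f' x c := by
  intro k' y h1 h2
  obtain rfl : k = k' := by simpa [hx] using hsub _ _ _ h1
  have hyz : y ≠ z := by
    rintro rfl
    simp [hnone] at h2
  exact hA (hf.mem hz) (hf.mem (hsub _ _ _ h2)) (hf.mem hx) hyz.symm hxz.symm

variable [Finite V] [Finite ι]

/-- The step along the fan at `u`. Let `u` miss a color, let `e = uv` be spare at `u` with color
`b`, and let `g = vw` be spare at `v` with color `c`. Then the choices of colors `b` and `c` can
be altered so that `c` becomes the color of a spare edge at `u`, while the edge chosen at `u`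
with color `c`, the spare edges at `u` other than `e`, and the spare edges at the vertices other
than `u` and `v` are kept.

The component of `v` for the colors `b` and `c` is a path from `v` to `w`. If it avoids `u`, it
is exchanged as a whole. Otherwise `e` is first chosen at `u` instead of the edge `uv'` of color
`b`; if necessary, `g` is chosen at `v` as well. This cuts a piece that contains `v'` but neither
`u` nor `v` out of the path, and that piece is exchanged. -/
theorem IsOptimal.exists_spareTo_shift (hA : AtMostTwoEnds A) (hf : IsOptimal A f)
    {u v w : V} {a b c : ι} {e g k : E} (hu : f u a = none) (h : SpareTo A f u e v b)
    (hg : SpareTo A f v g w c) (hk : f u c = some k) :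
    ∃ f', IsOptimal A f' ∧ (∀ x d, d ≠ b → d ≠ c → f' x d = f x d) ∧ f' u c = some k ∧
      (∃ e' y, SpareTo A f' u e' y c) ∧ (∀ x, x ≠ u → x ≠ v → KeepsSpare A f f' x) ∧
      ∀ e', e' ≠ e → Spare A f u e' → Spare A f' u e' := by
  obtain ⟨-, hcb⟩ := hf.color_ne hA hu h hg
  have hwv := hf.mem_component_of_spareTo hA hu h hg
  have hvu := h.ne
  have key : ∀ x, x ≠ u → x ≠ v → ∀ k y d, y ∈ component f b c v → (d = b ∨ d = c) →
      ¬ SpareTo A f x k y d := by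
    intro x hxu hxv k y d hy hd hx
    refine not_three_free hA hf.1 (h.free hA hf.1) (hg.free hA hf.1) (hx.free hA hf.1)
      (Or.inl rfl) (Or.inr rfl) hd (by simp [hcb.symm]) ?_ ?_ hwv hy
    · intro hh
      obtain ⟨rfl, rfl⟩ : v = y ∧ b = d := by simpa using hh
      obtain rfl : e = k := by simpa [h.2] using hx.2
      exact hxv (hA h.1.1 hx.1.1 (hf.1.mem h.2) hxu.symm hvu.symm)
    · intro hh
      obtain ⟨rfl, rfl⟩ : w = y ∧ c = d := by simpa using hh
      obtain rfl : g = k := by simpa [hg.2] using hx.2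
      exact hx.ne (hA hg.1.1 hx.1.1 (hf.1.mem hg.2) hxv.symm hg.ne.symm).symm
  by_cases huv : u ∈ component f b c v
  swap
  · refine ⟨_, hf.kempeSwap (isKempeClosed_component _ _ _ _),
      fun x d hb hc => kempeSwap_of_ne hb hc x, ?_, ⟨e, v, spare_kempeSwap.2 h.1, ?_⟩,
      fun x hxu hxv => keepsSpare_kempeSwap (key x hxu hxv), fun e' _ he' => spare_kempeSwap.2 he'⟩
    · rw [kempeSwap_of_notMem huv, hk]
    · rw [kempeSwap_right (mem_component_self ..), h.2]
  obtain ⟨e', he'⟩ := Option.ne_none_iff_exists'.1 (hf.ne_none h.1.1 h.2)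
  have hne : e' ≠ e := by
    rintro rfl
    exact h.1.2 _ he'
  -- `f₁` chooses `e` at `u` instead of `e'`.
  have hopt₁ := hf.reassign_spareTo h
  set f₁ := reassign f u b (some e) with hf₁
  obtain ⟨v', hv', hfv'⟩ := hf.exists_spareTo_reassign hu h he'
  have hv'u := hv'.ne
  have hv'v : v' ≠ v := by
    rintro rfl
    exact hne (by simpa [h.2] using hfv'.symm)
  -- `f₀` forgets the choices at which the component is cut.
  set f₀ := reassign (reassign f u b none) v c none with hf₀
  have hf₀opt : IsPartialChoice A f₀ := (hf.1.reassign_none _ _).reassign_none _ _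
  have hsub : ∀ y b k, f₀ y b = some k → f y b = some k := by
    intro y d' k hy
    have h1 : ¬ (y = v ∧ d' = c) := by
      rintro ⟨rfl, rfl⟩
      simp [hf₀] at hy
    rw [hf₀, reassign_of_ne h1] at hy
    have h2 : ¬ (y = u ∧ d' = b) := by
      rintro ⟨rfl, rfl⟩
      simp at hy
    rwa [reassign_of_ne h2] at hy
  have hkeep : ∀ y d', ¬ (y = v ∧ d' = c) → ¬ (y = u ∧ d' = b) → f₀ y d' = f y d' := by
    intro y d' h1 h2
    rw [hf₀, reassign_of_ne h1, reassign_of_ne h2]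
  have hf₀u : f₀ u b = none := by
    rw [hf₀, reassign_of_vertex_ne hvu.symm, reassign_self]
  have hf₀v : f₀ v c = none := by rw [hf₀, reassign_self]
  set C := component f₀ b c v' with hC
  have hCclosed := isKempeClosed_component f₀ b c v'
  rw [← hC] at hCclosed
  have hCsub : C ⊆ component f b c v := by
    refine component_subset (fun x hx y d' k hd' h1 h2 => ?_) ?_
    · exact isKempeClosed_component f b c v x hx y d' k hd' (hsub _ _ _ h1) (hsub _ _ _ h2)
    · exact isKempeClosed_component f b c v u huv v' b e' (Or.inl rfl) he' hfv'
  have hfree : Free f₀ v' b := free_of_partner_none hA hf.1 hsub hfv' he' hv'u hf₀u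
  have hvC : v ∉ C := fun hvC =>
    not_three_free hA hf₀opt hfree ((h.free hA hf.1).mono hsub) (free_of_none hf₀v)
      (Or.inl rfl) (Or.inl rfl) (Or.inr rfl) (by simp [hv'v]) (by simp [hv'v])
      (by simp [hcb.symm]) hvC hvC
  have hfreew : ∀ x k, f v c = some k → f x c = some k → x ≠ v → Free f₀ x c :=
    fun x k h1 h2 hxv => free_of_partner_none hA hf.1 hsub h2 h1 hxv hf₀v
  have huC : u ∉ C := by
    intro huC
    refine hvC (component_subset ?_ huC (mem_component_symm huv))
    intro x hx y d' k hd' h1 h2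
    have hxv : x ≠ v := by
      rintro rfl
      exact hvC hx
    by_cases hxu : x = u ∧ d' = b
    · obtain ⟨rfl, rfl⟩ := hxu
      by_cases hyx : y = x
      · exact hyx ▸ hx
      · obtain rfl : e' = k := by simpa [he'] using h1
        rw [hA (hf.1.mem he') (hf.1.mem h2) (hf.1.mem hfv') (Ne.symm hyx) hv'u.symm]
        exact mem_component_self ..
    by_cases hyu : y = u
    · exact hyu ▸ huC
    by_cases hyv : y = v ∧ d' = c
    · obtain ⟨rfl, rfl⟩ := hyv
      exact (not_three_free hA hf₀opt hfree (free_of_none hf₀u) (hfreew x k h2 h1 hxv)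
        (Or.inl rfl) (Or.inl rfl) (Or.inr rfl) (by simp [hv'u]) (by simp [hcb.symm])
        (by simp [hcb.symm]) huC hx).elim
    · exact hCclosed x hx y d' k hd' (by rwa [hkeep _ _ (by tauto) hxu])
        (by rwa [hkeep _ _ hyv (by tauto)])
  have hkeep₁ : ∀ x, x ≠ u → KeepsSpare A f f₁ x := fun x hxu =>
    keepsSpare_reassign hA hf.1 h (fun k hk' => ⟨v', hv'u, by
      rw [hfv', ← he', hk']⟩) hxu
  have hspu : ∀ l, l ≠ e → Spare A f u l → Spare A f₁ u l :=
    fun l hl hsl => spare_reassign_some hsl hl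
  -- It remains to exchange the colors on `C` after choosing `e` at `u` and possibly `g` at `v`.
  have finish : ∀ f' : V → ι → Option E, IsOptimal A f' → IsKempeClosed f' b c C →
      (∀ x d', d' ≠ b → d' ≠ c → f' x d' = f₁ x d') → (∀ x, x ≠ v → f' x = f₁ x) →
      (∀ x, x ≠ u → x ≠ v → KeepsSpare A f₁ f' x) →
      ∃ f', IsOptimal A f' ∧ (∀ x d', d' ≠ b → d' ≠ c → f' x d' = f x d') ∧ f' u c = some k ∧
        (∃ e' y, SpareTo A f' u e' y c) ∧ (∀ x, x ≠ u → x ≠ v → KeepsSpare A f f' x) ∧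
        ∀ e', e' ≠ e → Spare A f u e' → Spare A f' u e' := by
    intro f' hopt' hcl hcol hvert hks
    have hspu' : ∀ l, Spare A f' u l ↔ Spare A f₁ u l := fun l => by
      simp only [Spare, hvert u hvu.symm]
    refine ⟨_, hopt'.kempeSwap hcl, fun x d' h1 h2 => ?_, ?_,
      ⟨e', v', spare_kempeSwap.2 ((hspu' _).2 hv'.1), ?_⟩, fun x hxu hxv => ?_,
      fun l hl hsl => spare_kempeSwap.2 ((hspu' _).2 (hspu l hl hsl))⟩
    · rw [kempeSwap_of_ne h1 h2, hcol x d' h1 h2, hf₁, reassign_of_color_ne h1]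
    · rw [kempeSwap_of_notMem huC, hvert u hvu.symm, hf₁, reassign_of_color_ne hcb, hk]
    · rw [kempeSwap_right (mem_component_self ..), hvert v' hv'v, hf₁, hv'.2]
    · refine ((hkeep₁ x hxu).trans (hks x hxu hxv)).trans (keepsSpare_kempeSwap ?_)
      intro l y d' hy hd' hl
      have hyu : y ≠ u := fun hyu => huC (hyu ▸ hy)
      have hyv : y ≠ v := fun hyv => hvC (hyv ▸ hy)
      have hfx : f' x = f x := by
        rw [hvert x hxv]
        exact funext fun _ => reassign_of_vertex_ne hxu
      have hfy : f' y = f y := by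
        rw [hvert y hyv]
        exact funext fun _ => reassign_of_vertex_ne hyu
      refine key x hxu hxv l y d' (hCsub hy) hd' ⟨?_, hfy ▸ hl.2⟩
      have := hl.1
      simp only [Spare, hfx] at this
      exact this
  by_cases hw₁ : ∃ w₁ ∈ C, ∃ l, f v c = some l ∧ f w₁ c = some l
  · obtain ⟨w₁, hw₁C, l, hl, hl'⟩ := hw₁
    have hw₁v : w₁ ≠ v := fun hh => hvC (hh ▸ hw₁C)
    have hwC : w ∉ C := by
      intro hwC
      have hlg : l ≠ g := by
        rintro rfl
        exact hg.1.2 _ hl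
      refine not_three_free hA hf₀opt hfree (hfreew w₁ l hl hl' hw₁v) ((hg.free hA hf.1).mono hsub)
        (Or.inl rfl) (Or.inr rfl) (Or.inr rfl) (by simp [hcb.symm]) (by simp [hcb.symm]) ?_
        hw₁C hwC
      intro hh
      obtain rfl : w₁ = w := by simpa using hh
      exact hlg (by simpa [hl'] using hg.2)
    have hg₁ : SpareTo A f₁ v g w c :=
      ⟨(spare_reassign_of_ne hvu).2 hg.1, by rw [hf₁, reassign_of_color_ne hcb, hg.2]⟩
    refine finish _ (hopt₁.reassign_spareTo hg₁) ?_ (fun x d' _ hd' => reassign_of_color_ne hd')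
      (fun x hx => funext fun _ => reassign_of_vertex_ne hx) ?_
    · intro x hx y d' l' hd' h1 h2
      have hxu : x ≠ u := fun hh => huC (hh ▸ hx)
      have hxv : x ≠ v := fun hh => hvC (hh ▸ hx)
      rw [reassign_of_vertex_ne hxv, hf₁, reassign_of_vertex_ne hxu] at h1
      by_cases hyv : y = v ∧ d' = c
      · obtain ⟨rfl, rfl⟩ := hyv
        rw [reassign_self] at h2
        obtain rfl : g = l' := by simpa using h2
        exact absurd (hA hg.1.1 (hf.1.mem h1) (hf.1.mem hg.2) hxv.symm hg.ne.symm ▸ hx) hwC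
      rw [reassign_of_ne hyv] at h2
      by_cases hyu : y = u ∧ d' = b
      · obtain ⟨rfl, rfl⟩ := hyu
        rw [hf₁, reassign_self] at h2
        obtain rfl : e = l' := by simpa using h2
        exact absurd (hA h.1.1 (hf.1.mem h1) (hf.1.mem h.2) hxu.symm hvu.symm) hxv
      rw [hf₁, reassign_of_ne hyu] at h2
      exact hCclosed x hx y d' l' hd' (by rwa [hkeep _ _ (by tauto) (by tauto)])
        (by rwa [hkeep _ _ hyv hyu])
    · intro x hxu hxv
      refine keepsSpare_reassign hA hopt₁.1 hg₁ (fun l' hl₁ => ⟨w₁, hw₁v, ?_⟩) hxv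
      rw [hf₁, reassign_of_color_ne hcb] at hl₁ ⊢
      rw [hl', ← hl, hl₁]
  · refine finish f₁ hopt₁ ?_ (fun _ _ _ _ => rfl) (fun _ _ => rfl)
      fun x _ _ l hl => ⟨hl, fun _ _ => Iff.rfl⟩
    intro x hx y d' l' hd' h1 h2
    have hxu : x ≠ u := fun hh => huC (hh ▸ hx)
    have hxv : x ≠ v := fun hh => hvC (hh ▸ hx)
    rw [hf₁, reassign_of_vertex_ne hxu] at h1
    by_cases hyu : y = u ∧ d' = b
    · obtain ⟨rfl, rfl⟩ := hyu
      rw [hf₁, reassign_self] at h2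
      obtain rfl : e = l' := by simpa using h2
      exact absurd (hA h.1.1 (hf.1.mem h1) (hf.1.mem h.2) hxu.symm hvu.symm) hxv
    rw [hf₁, reassign_of_ne hyu] at h2
    by_cases hyv : y = v ∧ d' = c
    · obtain ⟨rfl, rfl⟩ := hyv
      exact absurd ⟨x, hx, l', h2, h1⟩ hw₁
    exact hCclosed x hx y d' l' hd' (by rwa [hkeep _ _ (by tauto) (by tauto)])
      (by rwa [hkeep _ _ hyv hyu])

end

/-! ### The fan at a vertex with a missing color -/

section

variable {V E ι : Type*} {A : V → Finset E} {f f' : V → ι → Option E}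

/-- A step of the fan at `u`: a spare edge at `x` has color `c ∉ B`, and `y` is the other end of the
edge chosen at `u` with color `c`. -/
def FanStep (A : V → Finset E) (f : V → ι → Option E) (u : V) (B : Set ι) (c : ι) (x y : V) :
    Prop :=
  c ∉ B ∧ (∃ h w, SpareTo A f x h w c) ∧ ∃ k, f u c = some k ∧ k ∈ A y ∧ y ≠ u

/-- The vertex `y` is reached from `x` by `n` steps of the fan at `u` that avoid the colors in
`B`. -/
inductive FanPath (A : V → Finset E) (f : V → ι → Option E) (u : V) (B : Set ι) :
    ℕ → V → V → Prop
  | refl (x : V) : FanPath A f u B 0 x x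
  | step {n : ℕ} {c : ι} {x y z : V} : FanStep A f u B c x y → FanPath A f u B n y z →
      FanPath A f u B (n + 1) x z

variable {u : V} {B B' : Set ι} {n : ℕ}

theorem FanPath.ne {x y : V} (h : FanPath A f u B n x y) (hx : x ≠ u) : y ≠ u := by
  induction h with
  | refl x => exact hx
  | step h _ ih =>
    obtain ⟨-, -, k, -, -, hy⟩ := h
    exact ih hy

theorem FanPath.trans {m : ℕ} {x y z : V} (h : FanPath A f u B n x y) (h' : FanPath A f u B m y z) :
    ∃ l, FanPath A f u B l x z := by
  induction h with
  | refl x => exact ⟨_, h'⟩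
  | step h _ ih =>
    obtain ⟨l, hl⟩ := ih h'
    exact ⟨_, .step h hl⟩

theorem FanPath.map {R : V → Prop} {x y : V} (h : FanPath A f u B n x y) (hx : R x)
    (hstep : ∀ c x y, R x → FanStep A f u B c x y → FanStep A f' u B' c x y ∧ R y) :
    FanPath A f' u B' n x y := by
  induction h with
  | refl x => exact .refl x
  | step h _ ih => exact .step (hstep _ _ _ hx h).1 (ih (hstep _ _ _ hx h).2)

theorem FanPath.mono {x y : V} (h : FanPath A f u B n x y) (hB : B' ⊆ B) :
    FanPath A f u B' n x y :=
  h.map (R := fun _ => True) trivial fun _ _ _ _ hs => ⟨⟨fun hc => hs.1 (hB hc), hs.2⟩, trivial⟩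

/-- A path of the fan either survives the shift along its first step, or it can be shortened. -/
theorem FanPath.shift (hA : AtMostTwoEnds A) (hf : IsPartialChoice A f) {b c : ι} {k : E}
    {v x₁ x y : V} (hk : f u c = some k) (hx₁ : k ∈ A x₁) (hx₁u : x₁ ≠ u)
    (hcol : ∀ d, d ≠ b → d ≠ c → f' u d = f u d)
    (hkeep : ∀ x, x ≠ u → x ≠ v → KeepsSpare A f f' x)
    (h : FanPath A f u {b} n x y) (hx : x ≠ u) :
    (FanPath A f' u {c} n x y ∧ y ≠ v) ∨ (∃ m ≤ n, FanPath A f u {b} m v y) ∨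
      ∃ m < n, FanPath A f u {b} m x₁ y := by
  induction h with
  | refl x =>
    by_cases hxv : x = v
    · exact Or.inr (Or.inl ⟨0, le_rfl, hxv ▸ .refl x⟩)
    · exact Or.inl ⟨.refl x, hxv⟩
  | @step n d x z y hs hp ih =>
    by_cases hxv : x = v
    · exact Or.inr (Or.inl ⟨_, le_rfl, hxv ▸ .step hs hp⟩)
    obtain ⟨hdb, ⟨l, w, hl⟩, k', hk', hkz, hzu⟩ := hs
    by_cases hdc : d = c
    · subst hdc
      obtain rfl : k = k' := by simpa [hk] using hk'
      obtain rfl := hA (hf.mem hk) hkz hx₁ hzu.symm hx₁u.symm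
      exact Or.inr (Or.inr ⟨_, Nat.lt_succ_self _, hp⟩)
    · rcases ih hzu with ⟨h1, h2⟩ | ⟨m, hm, h⟩ | ⟨m, hm, h⟩
      · exact Or.inl ⟨.step ⟨hdc, ⟨l, w, (hkeep x hx hxv).spareTo hl⟩, k',
          (hcol d hdb hdc).trans hk', hkz, hzu⟩ h1, h2⟩
      · exact Or.inr (Or.inl ⟨m, hm.trans (Nat.le_succ _), h⟩)
      · exact Or.inr (Or.inr ⟨m, hm.trans (Nat.lt_succ_self _), h⟩)

variable {a b c : ι} {e g : E} {v w x : V}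

protected theorem FanStep.kempeSwap {d : ι} {P : Set V} {y : V} (h : FanStep A f u B d x y)
    (hb : d ≠ b) (hc : d ≠ c) (hB : d ∉ B') : FanStep A (kempeSwap f b c P) u B' d x y := by
  obtain ⟨-, ⟨l, w, hl⟩, k, hk, h'⟩ := h
  exact ⟨hB, ⟨l, w, hl.kempeSwap_of_ne hb hc⟩, k, (kempeSwap_of_ne hb hc u).trans hk, h'⟩

variable [Finite V] [Finite ι]

/-- The fan step, followed by an exchange at `u`: the edge `k` chosen at `u` with color `c`
becomes spare. -/
theorem IsOptimal.exists_spareTo_shift_exchange (hA : AtMostTwoEnds A) (hf : IsOptimal A f)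
    {k : E} (hu : f u a = none) (h : SpareTo A f u e v b) (hg : SpareTo A f v g w c)
    (hk : f u c = some k) :
    ∃ f', IsOptimal A f' ∧ (∀ x d, d ≠ b → d ≠ c → f' x d = f x d) ∧ f' u a = none ∧
      (∃ z, SpareTo A f' u k z c) ∧ (∀ x, x ≠ u → x ≠ v → KeepsSpare A f f' x) ∧
      ∀ e' y d, d ≠ b → d ≠ c → SpareTo A f u e' y d → SpareTo A f' u e' y d := by
  obtain ⟨f₁, hopt, hcol, hk₁, ⟨l, y, hl⟩, hkeep, hspare⟩ := hf.exists_spareTo_shift hA hu h hg hk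
  have hab : a ≠ b := by
    rintro rfl
    exact hf.ne_none h.1.1 h.2 hu
  have hac : a ≠ c := by
    rintro rfl
    simp [hu] at hk
  have hu₁ : f₁ u a = none := by rw [hcol u a hab hac, hu]
  obtain ⟨z, hz, hz'⟩ := hopt.exists_spareTo_reassign hu₁ hl hk₁
  refine ⟨_, hopt.reassign_spareTo hl, fun x d hb hc => ?_, ?_, ⟨z, hz⟩, fun x hxu hxv => ?_,
    fun e' y d hb hc he' => ⟨spare_reassign_some (hspare e' ?_ he'.1) ?_, ?_⟩⟩
  · rw [reassign_of_color_ne hc, hcol x d hb hc]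
  · rw [reassign_of_color_ne hac, hu₁]
  · refine (hkeep x hxu hxv).trans (keepsSpare_reassign hA hopt.1 hl (fun k' hk' => ⟨z, hz.ne, ?_⟩)
      hxu)
    rw [hz', ← hk₁, hk']
  · rintro rfl
    exact hb (hf.1.color_unique he'.2 h.2)
  · rintro rfl
    exact hc (hopt.1.color_unique ((hcol y d hb hc).trans he'.2) hl.2)
  · rw [reassign_of_color_ne hc, hcol y d hb hc, he'.2]

/-- Let `u` miss a color, and let the fan at `u` start with a spare edge of color `b`. A spare
edge at a vertex of the fan is colored; if its color `c` is not `b`, then `c` is the color of an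
edge from `u` to another vertex, and of no spare edge at `u`. -/
theorem IsOptimal.fan_spareTo (hA : AtMostTwoEnds A) (n : ℕ) (hf : IsOptimal A f)
    (hu : f u a = none) (h : SpareTo A f u e v b) (hp : FanPath A f u {b} n v x)
    (hg : Spare A f x g) :
    ∃ w c, SpareTo A f x g w c ∧ (c ≠ b → (∃ k z, f u c = some k ∧ k ∈ A z ∧ z ≠ u) ∧
      ∀ e' y, ¬ SpareTo A f u e' y c) := by
  induction n using Nat.strong_induction_on generalizing f e v b with
  | _ n ih =>
    cases hp with
    | refl =>
      obtain ⟨w, c, hw, -, hcb⟩ := hf.exists_spareTo_of_spareTo hA hu h hg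
      refine ⟨w, c, hw, fun _ => ⟨?_, fun _ _ => hf.not_spareTo_of_spareTo hA hu h hw⟩⟩
      obtain ⟨k, hk⟩ := Option.ne_none_iff_exists'.1 (hf.color_ne hA hu h hw).1
      obtain ⟨f', hf', -, -, ⟨z, hz⟩, -, -⟩ := hf.exists_spareTo_shift_exchange hA hu h hw hk
      exact ⟨k, z, hk, hf'.1.mem hz.2, hz.ne⟩
    | @step n c _ x₁ _ hs hp =>
      obtain ⟨hcb, ⟨l, w, hl⟩, k, hk, hkx₁, hx₁u⟩ := hs
      obtain ⟨f', hf', hcol, hu', ⟨z, hz⟩, hkeep, hspare⟩ :=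
        hf.exists_spareTo_shift_exchange hA hu h hl hk
      obtain rfl := hA (hf.1.mem hk) (hf'.1.mem hz.2) hkx₁ hz.ne.symm hx₁u.symm
      rcases hp.shift hA hf.1 hk hkx₁ hx₁u (fun d => hcol u d) hkeep hx₁u with
        ⟨hp', hxv⟩ | ⟨m, hm, hp'⟩ | ⟨m, hm, hp'⟩
      · have hks := hkeep x (hp.ne hx₁u) hxv g hg
        obtain ⟨w', c', hw', h'⟩ := ih n (Nat.lt_succ_self _) hf' hu' hz hp' hks.1
        refine ⟨w', c', ⟨hg, (hks.2 _ _).2 hw'.2⟩, fun hcb' => ?_⟩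
        by_cases hcc : c' = c
        · subst hcc
          exact ⟨⟨k, _, hk, hkx₁, hx₁u⟩, fun _ _ => hf.not_spareTo_of_spareTo hA hu h hl⟩
        · obtain ⟨⟨k', z', hk', hz'⟩, h''⟩ := h' hcc
          exact ⟨⟨k', z', (hcol u c' hcb' hcc).symm.trans hk', hz'⟩,
            fun e' y he' => h'' e' y (hspare e' y c' hcb' hcc he')⟩
      · exact ih m (Nat.lt_succ_of_le hm) hf hu h hp' hg
      · exact ih (m + 1) (Nat.succ_lt_succ hm) hf hu h
          (.step ⟨hcb, ⟨l, w, hl⟩, k, hk, hkx₁, hx₁u⟩ hp') hg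

theorem IsOptimal.fan_color (hA : AtMostTwoEnds A) (hf : IsOptimal A f)
    (hu : f u a = none) (h : SpareTo A f u e v b) (hp : FanPath A f u {b} n v x)
    (hg : SpareTo A f x g w c) (hcb : c ≠ b) :
    (∃ k z, f u c = some k ∧ k ∈ A z ∧ z ≠ u) ∧ ∀ e' y, ¬ SpareTo A f u e' y c := by
  obtain ⟨w', c', hw', h'⟩ := hf.fan_spareTo hA n hu h hp hg.1
  obtain rfl := hf.1.color_unique hw'.2 hg.2
  exact h' hcb

/-- With two spare edges of different colors at `u`, the starting color does not return in the
fan. -/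
theorem IsOptimal.fan_color_ne (hA : AtMostTwoEnds A) (hf : IsOptimal A f)
    {v₂ : V} {b₂ : ι} {e₂ : E} (hu : f u a = none) (h : SpareTo A f u e v b)
    (h₂ : SpareTo A f u e₂ v₂ b₂) (hb : b₂ ≠ b) (hp : FanPath A f u {b} n v x)
    (hg : SpareTo A f x g w c) : c ≠ b := by
  rintro rfl
  have hxu : x ≠ u := hp.ne h.ne
  have hv₂ := hf.mem_component_of_spareTo_of_ne hA hu h h₂ hb.symm
  have hw : w ∉ component f c b₂ v := by
    intro hw
    refine not_three_free hA hf.1 (h.free hA hf.1) (h₂.free hA hf.1) (hg.free hA hf.1)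
      (Or.inl rfl) (Or.inr rfl) (Or.inl rfl) (by simp [hb.symm]) ?_ (by simp [hb]) hv₂ hw
    intro hvw
    obtain rfl : v = w := by simpa using hvw
    obtain rfl : e = g := by simpa [h.2] using hg.2
    exact hg.ne (hA h.1.1 (hf.1.mem h.2) hg.1.1 h.ne.symm hxu.symm)
  have hv : v ∉ component f c b₂ w := fun hv => hw (mem_component_symm hv)
  have hv₂' : v₂ ∉ component f c b₂ w := fun hv => hw (by
    rw [← component_eq hv₂]; exact mem_component_symm hv)
  have hab : a ≠ c := by
    rintro rfl
    exact hf.ne_none h.1.1 h.2 hu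
  have hab₂ : a ≠ b₂ := by
    rintro rfl
    exact hf.ne_none h₂.1.1 h₂.2 hu
  have hopt := hf.kempeSwap (isKempeClosed_component f c b₂ w)
  refine (hopt.fan_color hA (a := a) (n := n) (x := x) (g := g) (w := w) (c := b₂)
    ((kempeSwap_of_ne hab hab₂ u).trans hu) (h.kempeSwap_of_notMem hv) ?_ ?_ hb).2
    e₂ v₂ (h₂.kempeSwap_of_notMem hv₂')
  · refine hp.map (R := fun y => ∃ m, FanPath A f u {c} m v y) ⟨0, .refl v⟩ ?_
    rintro d y z ⟨m, hm⟩ hs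
    obtain ⟨hd, ⟨l, w', hl⟩, -⟩ := id hs
    refine ⟨hs.kempeSwap hd ?_ hd, hm.trans (.step hs (.refl z))⟩
    rintro rfl
    exact (hf.fan_color hA hu h hm hl hd).2 _ _ h₂
  · exact ⟨spare_kempeSwap.2 hg.1, (kempeSwap_right (mem_component_self ..)).trans hg.2⟩

end

/-! ### Spare edges in the fan have distinct colors -/

section

variable {V E ι : Type*} {A : V → Finset E} {f : V → ι → Option E} {u : V}

/-- Up to its first step of color `c`, a path of the fan avoids `c`. -/
theorem FanPath.avoid_or_exists_spareTo {n : ℕ} {b c : ι} {x y : V}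
    (h : FanPath A f u {b} n x y) : FanPath A f u {b, c} n x y ∨
      ∃ m z h w, FanPath A f u {b, c} m x z ∧ SpareTo A f z h w c := by
  induction h with
  | refl x => exact Or.inl (.refl x)
  | @step n d x y z hs hp ih =>
    obtain ⟨hd, ⟨l, w, hl⟩, hs'⟩ := hs
    by_cases hdc : d = c
    · subst hdc
      exact Or.inr ⟨0, x, l, w, .refl x, hl⟩
    have hs : FanStep A f u {b, c} d x y := ⟨by simpa [hdc] using hd, ⟨l, w, hl⟩, hs'⟩
    rcases ih with h | ⟨m, z', h', w', hm, h⟩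
    · exact Or.inl (.step hs h)
    · exact Or.inr ⟨_, z', h', w', .step hs hm, h⟩

/-- After its last step of color `c`, a path of the fan avoids `c`. -/
theorem FanPath.avoid_or_exists_suffix {n : ℕ} {b c : ι} {x y : V}
    (h : FanPath A f u {b} n x y) : FanPath A f u {b, c} n x y ∨
      ∃ m z k, f u c = some k ∧ k ∈ A z ∧ z ≠ u ∧ FanPath A f u {b, c} m z y := by
  induction h with
  | refl x => exact Or.inl (.refl x)
  | @step n d x y z hs hp ih =>
    rcases ih with h | h
    · obtain ⟨hd, hl, k, hk, hky, hyu⟩ := hs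
      by_cases hdc : d = c
      · subst hdc
        exact Or.inr ⟨_, y, k, hk, hky, hyu, h⟩
      · exact Or.inl (.step ⟨by simpa [hdc] using hd, hl, k, hk, hky, hyu⟩ h)
    · exact Or.inr h

theorem SpareTo.ends_ne (hA : AtMostTwoEnds A) (hf : IsPartialChoice A f) {x y w w' : V} {c : ι}
    {g g' : E} (hg : SpareTo A f x g w c) (hg' : SpareTo A f y g' w' c) (hne : (x, g) ≠ (y, g')) :
    w ≠ w' := by
  rintro rfl
  obtain rfl : g = g' := by simpa [hg.2] using hg'.2
  exact hne (by rw [hA (hf.mem hg.2) hg.1.1 hg'.1.1 hg.ne hg'.ne])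

variable [Finite V] [Finite ι] {a b c b₂ : ι} {e e₂ g g' : E} {v v₂ w w' x y : V} {m n : ℕ}

/-- If the component of `w` for the colors `b₂` and `c` avoids the end `v₂` of a spare edge of
color `b₂` at `u`, then a spare edge `g = xw` of color `c` with `x` in the fan turns, by
exchanging the colors in the component, into one whose color occurs on a spare edge at `u`. So
the fan does not survive the exchange. -/
theorem IsOptimal.not_fanPath_kempeSwap (hA : AtMostTwoEnds A) (hf : IsOptimal A f)
    (hu : f u a = none) (h : SpareTo A f u e v b) (h₂ : SpareTo A f u e₂ v₂ b₂) (hb : b₂ ≠ b)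
    (hc : f u c ≠ none) (hcb : c ≠ b) (hg : SpareTo A f x g w c)
    (hw : v₂ ∉ component f b₂ c w) :
    ¬ FanPath A (kempeSwap f b₂ c (component f b₂ c w)) u {b} n v x := by
  intro hp
  have hab₂ : a ≠ b₂ := by
    rintro rfl
    exact hf.ne_none h₂.1.1 h₂.2 hu
  have hac : a ≠ c := by
    rintro rfl
    exact hc hu
  exact ((hf.kempeSwap (isKempeClosed_component f b₂ c w)).fan_color hA (a := a) (g := g) (w := w)
    (c := b₂) ((kempeSwap_of_ne hab₂ hac u).trans hu) (h.kempeSwap_of_ne hb.symm hcb.symm) hp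
    ⟨spare_kempeSwap.2 hg.1, (kempeSwap_left (mem_component_self ..)).trans hg.2⟩ hb).2
    e₂ v₂ (h₂.kempeSwap_of_notMem hw)

/-- Two spare edges of the same color at vertices of the fan coincide, if one of these vertices is
reached by a path that avoids this color. -/
theorem IsOptimal.fan_spareTo_unique_of_avoid (hA : AtMostTwoEnds A) (hf : IsOptimal A f)
    (hu : f u a = none) (h : SpareTo A f u e v b) (h₂ : SpareTo A f u e₂ v₂ b₂) (hb : b₂ ≠ b)
    (hp : FanPath A f u {b, c} n v x) (hg : SpareTo A f x g w c)
    (hp' : FanPath A f u {b} m v y) (hg' : SpareTo A f y g' w' c) : (x, g) = (y, g') := by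
  by_contra hne
  have hww := hg.ends_ne hA hf.1 hg' hne
  have hpb : FanPath A f u {b} n v x := hp.mono (by simp)
  have hcb : c ≠ b := hf.fan_color_ne hA hu h h₂ hb hpb hg
  obtain ⟨⟨k, z, hk, hkz, hzu⟩, hc⟩ := hf.fan_color hA hu h hpb hg hcb
  have hcb₂ : c ≠ b₂ := by
    rintro rfl
    exact hc _ _ h₂
  have hcn : f u c ≠ none := by simp [hk]
  have hab₂ : a ≠ b₂ := by
    rintro rfl
    exact hf.ne_none h₂.1.1 h₂.2 hu
  have hac : a ≠ c := by
    rintro rfl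
    exact hcn hu
  -- Steps from vertices of the fan never have color `b₂`, so those that avoid `c` survive any
  -- exchange of `b₂` and `c`.
  let R : V → Prop := fun y => ∃ m, FanPath A f u {b} m v y
  have hRu : ∀ y, R y → y ≠ u := fun y ⟨m, hm⟩ => hm.ne h.ne
  have hR : ∀ d y z, R y → FanStep A f u {b, c} d y z → d ≠ b ∧ d ≠ c ∧ d ≠ b₂ ∧ R z := by
    rintro d y z ⟨m, hm⟩ hs
    obtain ⟨hd, ⟨l, w, hl⟩, hs'⟩ := id hs
    simp only [Set.mem_insert_iff, Set.mem_singleton_iff, not_or] at hd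
    refine ⟨hd.1, hd.2, ?_, hm.trans (.step ⟨hd.1, ⟨l, w, hl⟩, hs'⟩ (.refl z))⟩
    rintro rfl
    exact (hf.fan_color hA hu h hm hl hd.1).2 _ _ h₂
  have hmap : ∀ P : Set V, ∀ n x y, R x → FanPath A f u {b, c} n x y →
      FanPath A (kempeSwap f b₂ c P) u {b} n x y := fun P n x y hx hp =>
    hp.map (R := R) hx fun d y z hy hs => by
      obtain ⟨h1, h2, h3, h4⟩ := hR d y z hy hs
      exact ⟨hs.kempeSwap h3 h2 h1, h4⟩
  have hRv : R v := ⟨0, .refl v⟩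
  by_cases hw : v₂ ∈ component f b₂ c w
  swap
  · exact hf.not_fanPath_kempeSwap hA hu h h₂ hb hcn hcb hg hw (hmap _ n v x hRv hp)
  have hw₂ : w ∈ component f b₂ c v₂ := mem_component_symm hw
  have hw' : w' ∉ component f b₂ c v₂ := fun hw' =>
    not_three_free hA hf.1 (h₂.free hA hf.1) (hg.free hA hf.1) (hg'.free hA hf.1)
      (Or.inl rfl) (Or.inr rfl) (Or.inr rfl) (by simp [hcb₂.symm]) (by simp [hcb₂.symm])
      (by simp [hww]) hw₂ hw'
  have hv₂ : v₂ ∉ component f b₂ c w' := fun hh => hw' (mem_component_symm hh)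
  have hwP : w ∉ component f b₂ c w' := fun hh => hw' (by
    rw [← component_eq hw₂]; exact mem_component_symm hh)
  have hopt := hf.kempeSwap (isKempeClosed_component f b₂ c w')
  have hnot := hf.not_fanPath_kempeSwap hA (n := m) hu h h₂ hb hcn hcb hg' hv₂
  have hmap' := hmap (component f b₂ c w')
  rcases hp'.avoid_or_exists_suffix (c := c) with hp' | ⟨l, z', k', hk', hkz', hzu', hp'⟩
  · exact hnot (hmap' m v y hRv hp')
  obtain rfl : k = k' := by simpa [hk] using hk'
  obtain rfl : z = z' := hA (hf.1.mem hk) hkz hkz' hzu.symm hzu'.symm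
  have hRz : R z := hpb.trans (.step ⟨hcb, ⟨g, w, hg⟩, k, hk, hkz, hzu⟩ (.refl z))
  by_cases huP : u ∈ component f b₂ c w'
  · -- The exchange gives color `b₂` to the edge `k = uz`, so the fan can start at `z`.
    set f₁ := kempeSwap f b₂ c (component f b₂ c w') with hf₁
    have hu₁ : f₁ u a = none := (kempeSwap_of_ne hab₂ hac u).trans hu
    have hk₁ : f₁ u b₂ = some k := (kempeSwap_left huP).trans hk
    have h₂₁ : SpareTo A f₁ u e₂ v₂ b₂ := h₂.kempeSwap_of_notMem hv₂
    have h₁ : SpareTo A f₁ u e v b := h.kempeSwap_of_ne hb.symm hcb.symm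
    have hg₁ : SpareTo A f₁ y g' w' b₂ :=
      ⟨spare_kempeSwap.2 hg'.1, (kempeSwap_left (mem_component_self ..)).trans hg'.2⟩
    obtain ⟨z', hz', hz₁⟩ := hopt.exists_spareTo_reassign hu₁ h₂₁ hk₁
    obtain rfl : z = z' := hA (hf.1.mem hk) hkz (hopt.1.mem hz₁) hzu.symm hz'.ne.symm
    have hkeep : ∀ x, x ≠ u → KeepsSpare A f₁ (reassign f₁ u b₂ (some e₂)) x := fun x hx =>
      keepsSpare_reassign hA hopt.1 h₂₁ (fun k' hk' => ⟨z, hzu, by rw [hz₁, ← hk₁, hk']⟩) hx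
    have hyu : y ≠ u := hp'.ne hzu
    refine (hopt.reassign_spareTo h₂₁).fan_color_ne hA (a := a) (n := l) (e₂ := e) (v₂ := v)
      ?_ hz' ⟨spare_reassign_some h₁.1 ?_, ?_⟩ hb.symm ?_ ((hkeep y hyu).spareTo hg₁) rfl
    · rw [reassign_of_color_ne hab₂, hu₁]
    · rintro rfl
      exact hb (hf.1.color_unique h₂.2 h.2)
    · rw [reassign_of_color_ne hb.symm, h₁.2]
    · refine hp'.map (R := R) hRz fun d y z hy hs => ?_
      obtain ⟨h1, h2, h3, h4⟩ := hR d y z hy hs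
      obtain ⟨-, ⟨l, w, hl⟩, k, hk, hky, hzu⟩ := hs
      refine ⟨⟨h3, ⟨l, w, (hkeep y (hRu y hy)).spareTo (hl.kempeSwap_of_ne h3 h2)⟩,
        k, ?_, hky, hzu⟩, h4⟩
      rw [reassign_of_color_ne h3, hf₁, kempeSwap_of_ne h3 h2, hk]
  · -- The exchange keeps `g`, and so the step to `z`.
    have hpx := hmap' n v x hRv hp
    have hpy := hmap' l z y hRz hp'
    obtain ⟨j, hj⟩ := hpx.trans (.step ⟨hcb, ⟨g, w, hg.kempeSwap_of_notMem hwP⟩, k,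
      (kempeSwap_of_notMem huP c).trans hk, hkz, hzu⟩ hpy)
    exact hf.not_fanPath_kempeSwap hA hu h h₂ hb hcn hcb hg' hv₂ hj

/-- With two spare edges of different colors at `u`, the spare edges at the vertices of the fan have
distinct colors. -/
theorem IsOptimal.fan_spareTo_unique (hA : AtMostTwoEnds A) (hf : IsOptimal A f)
    (hu : f u a = none) (h : SpareTo A f u e v b) (h₂ : SpareTo A f u e₂ v₂ b₂) (hb : b₂ ≠ b)
    (hp : FanPath A f u {b} n v x) (hg : SpareTo A f x g w c)
    (hp' : FanPath A f u {b} m v y) (hg' : SpareTo A f y g' w' c) : (x, g) = (y, g') := by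
  rcases hp.avoid_or_exists_spareTo (c := c) with hp₁ | ⟨l, z, k, w₁, hp₁, hk⟩
  · exact hf.fan_spareTo_unique_of_avoid hA hu h h₂ hb hp₁ hg hp' hg'
  · exact (hf.fan_spareTo_unique_of_avoid hA hu h h₂ hb hp₁ hk hp hg).symm.trans
      (hf.fan_spareTo_unique_of_avoid hA hu h h₂ hb hp₁ hk hp' hg')

end

/-! ### The finite theorem, compactness, and matchings -/

section

variable {V E ι : Type*} {A : V → Finset E} {f : V → ι → Option E}

theorem exists_isOptimal [Finite V] [Finite ι] (A : V → Finset E) :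
    ∃ f : V → ι → Option E, IsOptimal A f := by
  let S : Set ℕ := {k | ∃ f : V → ι → Option E, IsPartialChoice A f ∧ (filled f).ncard = k}
  have hS : S.Nonempty := ⟨_, fun _ _ => none, ⟨by simp, by simp⟩, rfl⟩
  have hb : BddAbove S := ⟨Nat.card (V × ι), by
    rintro _ ⟨f, -, rfl⟩
    exact Set.ncard_le_card _⟩
  obtain ⟨f, hf, hfk⟩ := Nat.sSup_mem hS hb
  exact ⟨f, hf, fun g hg => hfk ▸ le_csSup hb ⟨g, hg, rfl⟩⟩

open Classical in
/-- The edges that are spare at `x`. -/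
noncomputable def spareFinset (A : V → Finset E) (f : V → ι → Option E) (x : V) : Finset E :=
  (A x).filter fun e => ∀ c, f x c ≠ some e

theorem mem_spareFinset {x : V} {e : E} : e ∈ spareFinset A f x ↔ Spare A f x e := by
  simp [spareFinset, Spare]

/-- At most one available edge per color is not spare. -/
theorem card_le_card_spareFinset_add {x : V} (T : Finset ι) (hT : ∀ c, f x c ≠ none → c ∈ T) :
    #(A x) ≤ #(spareFinset A f x) + #T := by
  classical
  rw [spareFinset, ← card_filter_add_card_filter_not (s := A x) fun e => ∀ c, f x c ≠ some e]
  refine Nat.add_le_add_left ?_ _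
  have h : ∀ e : {e // e ∈ {e ∈ A x | ¬ ∀ c, f x c ≠ some e}}, ∃ c, f x c = some e.1 := by
    rintro ⟨e, he⟩
    simpa using (mem_filter.1 he).2
  choose col hcol using h
  rw [← card_attach]
  refine card_le_card_of_injOn col (fun e _ => hT _ (by simp [hcol e])) ?_
  intro e _ e' _ hee
  have := hcol e
  rw [hee, hcol e'] at this
  exact Subtype.ext (by simpa using this.symm)

/-- If every vertex has at least `μ` more edges than there are colors, where `μ` bounds
the edge multiplicities, then an optimal choice has no missing color. -/
theorem IsOptimal.forall_ne_none [Finite V] [Fintype ι] [DecidableEq E] (hA : AtMostTwoEnds A)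
    (hf : IsOptimal A f) {μ : ℕ} (hμ : ∀ x y, x ≠ y → #(A x ∩ A y) ≤ μ)
    (hdeg : ∀ x, Fintype.card ι + μ ≤ #(A x)) (u : V) (a : ι) : f u a ≠ none := by
  classical
  cases nonempty_fintype V
  intro hu
  have hspare : ∀ x, μ ≤ #(spareFinset A f x) := by
    intro x
    have h1 := card_le_card_spareFinset_add (A := A) (f := f) (x := x) univ (by simp)
    have h2 := hdeg x
    rw [card_univ] at h1
    omega
  have hspareu : μ + 1 ≤ #(spareFinset A f u) := by
    have h1 := card_le_card_spareFinset_add (A := A) (f := f) (x := u) (univ.erase a) (by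
      intro c hc
      refine mem_erase.2 ⟨?_, mem_univ _⟩
      rintro rfl
      exact hc hu)
    have h2 := hdeg u
    rw [card_erase_of_mem (mem_univ _), card_univ] at h1
    have h3 : 0 < Fintype.card ι := Fintype.card_pos_iff.2 ⟨a⟩
    omega
  obtain ⟨e, he⟩ := card_pos.1 (Nat.succ_pos _ |>.trans_le hspareu)
  obtain ⟨v, b, h⟩ := hf.exists_spareTo hu (mem_spareFinset.1 he)
  have hev : e ∈ A u ∩ A v := mem_inter.2 ⟨h.1.1, hf.1.mem h.2⟩
  have hμ1 : 1 ≤ μ := (card_pos.2 ⟨e, hev⟩).trans_le (hμ u v h.ne.symm)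
  obtain ⟨e₂, he₂, hne⟩ := exists_mem_ne (s := spareFinset A f u) (by omega) e
  obtain ⟨v₂, b₂, h₂⟩ := hf.exists_spareTo hu (mem_spareFinset.1 he₂)
  have hb : b₂ ≠ b := by
    rintro rfl
    exact hne (hf.spareTo_unique hA hu h₂ h)
  let S : Finset V := univ.filter fun x => ∃ n, FanPath A f u {b} n v x
  have hS : ∀ x ∈ S, ∃ n, FanPath A f u {b} n v x := fun x hx => (mem_filter.1 hx).2
  have hvS : v ∈ S := mem_filter.2 ⟨mem_univ _, 0, .refl v⟩
  -- Each spare edge at a vertex of the fan gives an edge from `u` to the fan.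
  have hex : ∀ p : {p : Σ _ : V, E // p ∈ S.sigma fun x => spareFinset A f x}, ∃ w c k,
      SpareTo A f p.1.1 p.1.2 w c ∧ f u c = some k ∧ k ∈ S.biUnion fun z => A u ∩ A z := by
    rintro ⟨⟨x, g⟩, hp⟩
    obtain ⟨hx, hg⟩ := mem_sigma.1 hp
    obtain ⟨n, hn⟩ := hS x hx
    obtain ⟨w, c, hw, -⟩ := hf.fan_spareTo hA n hu h hn (mem_spareFinset.1 hg)
    have hcb := hf.fan_color_ne hA hu h h₂ hb hn hw
    obtain ⟨⟨k, z, hk, hkz, hzu⟩, -⟩ := hf.fan_color hA hu h hn hw hcb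
    refine ⟨w, c, k, hw, hk, mem_biUnion.2 ⟨z, mem_filter.2 ⟨mem_univ _, ?_⟩,
      mem_inter.2 ⟨hf.1.mem hk, hkz⟩⟩⟩
    exact hn.trans (.step ⟨hcb, ⟨g, w, hw⟩, k, hk, hkz, hzu⟩ (.refl z))
  choose w c k hw hk hkS using hex
  have hinj : Function.Injective k := by
    rintro ⟨⟨x, g⟩, hp⟩ ⟨⟨y, g'⟩, hq⟩ hpq
    have hcc := hf.1.color_unique (hk ⟨⟨x, g⟩, hp⟩) (hpq ▸ hk ⟨⟨y, g'⟩, hq⟩)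
    obtain ⟨n, hn⟩ := hS x (mem_sigma.1 hp).1
    obtain ⟨m, hm⟩ := hS y (mem_sigma.1 hq).1
    have := hf.fan_spareTo_unique hA hu h h₂ hb hn (hw ⟨⟨x, g⟩, hp⟩) hm
      (hcc ▸ hw ⟨⟨y, g'⟩, hq⟩)
    simpa using this
  have hsub : insert e (univ.image k) ⊆ S.biUnion fun z => A u ∩ A z := by
    refine insert_subset (mem_biUnion.2 ⟨v, hvS, hev⟩) fun l hl => ?_
    obtain ⟨p, -, rfl⟩ := mem_image.1 hl
    exact hkS p
  have heim : e ∉ univ.image k := by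
    intro hl
    obtain ⟨p, -, hp⟩ := mem_image.1 hl
    exact h.1.2 _ (hp ▸ hk p)
  have h1 := card_le_card hsub
  rw [card_insert_of_notMem heim, card_image_of_injective _ hinj, card_univ, Fintype.card_coe,
    card_sigma] at h1
  have h2 : #(S.biUnion fun z => A u ∩ A z) ≤ #S * μ :=
    card_biUnion_le_card_mul _ _ _ fun z hz => hμ u z <| by
      obtain ⟨n, hn⟩ := hS z hz
      exact (hn.ne h.ne).symm
  have h3 : #S * μ ≤ ∑ x ∈ S, #(spareFinset A f x) := by
    rw [← smul_eq_mul]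
    exact card_nsmul_le_sum _ _ _ fun x _ => hspare x
  omega

/-- A choice without missing colors gives a coloring of all edges. -/
theorem IsPartialChoice.exists_coloring [Nonempty ι] (hf : IsPartialChoice A f)
    (h : ∀ x i, f x i ≠ none) : ∃ c : E → ι, ∀ x i, ∃ e ∈ A x, c e = i := by
  classical
  choose g hg using fun x i => Option.ne_none_iff_exists'.1 (h x i)
  refine ⟨fun e => if he : ∃ i x, f x i = some e then he.choose else Classical.arbitrary ι,
    fun x i => ⟨g x i, hf.mem (hg x i), ?_⟩⟩
  have he : ∃ j y, f y j = some (g x i) := ⟨i, x, hg x i⟩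
  obtain ⟨y, hy⟩ := he.choose_spec
  exact (dif_pos he).trans (hf.color_unique hy (hg x i))

/-- Gupta's theorem, for finitely many edges at each of possibly infinitely many
vertices. -/
theorem exists_coloring [Fintype ι] [Nonempty ι] [DecidableEq E] (hA : AtMostTwoEnds A) {μ : ℕ}
    (hμ : ∀ x y, x ≠ y → #(A x ∩ A y) ≤ μ) (hdeg : ∀ x, Fintype.card ι + μ ≤ #(A x)) :
    ∃ c : E → ι, ∀ x i, ∃ e ∈ A x, c e = i := by
  let _ : TopologicalSpace ι := ⊥
  have : DiscreteTopology ι := ⟨rfl⟩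
  let C : V → Set (E → ι) := fun x => {c | ∀ i, ∃ e ∈ A x, c e = i}
  have hC : ∀ x, IsClosed (C x) := by
    intro x
    have : C x = ⋂ i, ⋃ e ∈ A x, {c : E → ι | c e = i} := by
      ext c
      simp [C]
    rw [this]
    exact isClosed_iInter fun i => isClosed_biUnion_finset fun e _ =>
      isClosed_eq (continuous_apply e) continuous_const
  have hfin : ∀ s : Finset V, (⋂ x ∈ s, C x).Nonempty := by
    intro s
    let A' : s → Finset E := fun x => A x
    have hA' : AtMostTwoEnds A' := fun hx hy hz hxy hxz =>
      Subtype.ext (hA hx hy hz (fun h => hxy (Subtype.ext h)) fun h => hxz (Subtype.ext h))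
    obtain ⟨f, hf⟩ := exists_isOptimal (ι := ι) A'
    obtain ⟨c, hc⟩ := hf.1.exists_coloring (hf.forall_ne_none hA'
      (fun x y hxy => hμ x y fun h => hxy (Subtype.ext h)) fun x => hdeg x)
    exact ⟨c, Set.mem_iInter₂.2 fun x hx => hc ⟨x, hx⟩⟩
  obtain ⟨c, hc⟩ := CompactSpace.iInter_nonempty hC hfin
  exact ⟨c, fun x => Set.mem_iInter.1 hc x⟩

/-- If every vertex has at least twice as many edges as there are colors, then each vertex can be
given its own edges of all colors. -/
theorem exists_coloring_of_two_mul_card_le [Fintype ι] [Nonempty ι] [DecidableEq E]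
    (hA : AtMostTwoEnds A) (hdeg : ∀ x, 2 * Fintype.card ι ≤ #(A x)) :
    ∃ c : E → ι, ∀ x i, ∃ e ∈ A x, c e = i := by
  classical
  obtain ⟨g, hg, hgA⟩ := (Finset.all_card_le_biUnion_card_iff_exists_injective
    fun p : V × ι => A p.1).1 <| by
    intro s
    set S := s.image Prod.fst
    have hs : #s ≤ #S * Fintype.card ι := by
      rw [← card_univ, ← card_product]
      exact card_le_card fun p hp => mem_product.2 ⟨mem_image_of_mem _ hp, mem_univ _⟩
    have hU : s.biUnion (fun p => A p.1) = S.biUnion A := by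
      ext e
      simp [S]
    have h1 : ∑ x ∈ S, #(A x) ≤ #(S.biUnion A) * 2 := by
      have := sum_card_bipartiteAbove_eq_sum_card_bipartiteBelow (s := S) (t := S.biUnion A)
        fun x e => e ∈ A x
      have h2 : ∑ x ∈ S, #(A x) =
          ∑ x ∈ S, #((S.biUnion A).bipartiteAbove (fun x e => e ∈ A x) x) := by
        refine sum_congr rfl fun x hx => congrArg _ ?_
        ext e
        simp only [mem_bipartiteAbove, mem_biUnion]
        exact ⟨fun h => ⟨⟨x, hx, h⟩, h⟩, fun h => h.2⟩
      rw [h2, this, ← smul_eq_mul]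
      refine sum_le_card_nsmul _ _ _ fun e _ => ?_
      by_contra! h3
      obtain ⟨x, y, z, hx, hy, hz, hxy, hxz, hyz⟩ := two_lt_card_iff.1 h3
      simp only [mem_bipartiteBelow] at hx hy hz
      exact hyz (hA hx.2 hy.2 hz.2 hxy hxz)
    have h2 : #S * (2 * Fintype.card ι) ≤ ∑ x ∈ S, #(A x) := by
      rw [← smul_eq_mul]
      exact card_nsmul_le_sum _ _ _ fun x _ => hdeg x
    rw [hU]
    nlinarith
  refine IsPartialChoice.exists_coloring (f := fun x i => some (g (x, i))) (A := A) ⟨?_, ?_⟩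
    (by simp)
  · intro x i e h
    obtain rfl : g (x, i) = e := by simpa using h
    exact hgA (x, i)
  · intro x y i j e h h'
    have h1 : g (x, i) = g (y, j) := by simp_all
    exact congrArg Prod.snd (hg h1)

end

end SpareColoring

/-! ### Graphs -/

namespace Graph

theorem exists_finset_subset_incidenceSet {α β : Type*} (G : Graph α β) {x : α} {m : ℕ}
    (h : (m : Cardinal) ≤ G.cardDegree x) :
    ∃ s : Finset β, s.card = m ∧ ∀ e ∈ s, G.Inc e x := by
  obtain ⟨t, ht⟩ := Cardinal.exists_finset_eq_card h
  refine ⟨t.map (Function.Embedding.subtype _), by rw [Finset.card_map, ← ht], fun e he => ?_⟩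
  obtain ⟨e, -, rfl⟩ := Finset.mem_map.1 he
  exact e.2

/-- A good coloring over `X` by finitely many colors may be given by a function into
`Fin n`. -/
theorem exists_isGoodColoringOver {α β : Type*} (G : Graph α β) {n : ℕ} {X : Set α}
    {A : X → Finset β} (hA : ∀ x, ∀ e ∈ A x, G.Inc e x)
    (h : ∃ c : β → Fin n, ∀ x i, ∃ e ∈ A x, c e = i) :
    ∃ c : G.edgeSet →. Ordinal, G.IsGoodColoringOver (n : Cardinal) c X := by
  obtain ⟨c, hc⟩ := h
  refine ⟨fun e => Part.some ((c e : ℕ) : Ordinal), fun x hx _ i hi => ?_⟩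
  rw [Cardinal.ord_natCast] at hi
  obtain ⟨k, rfl⟩ := Ordinal.lt_omega0.1 (hi.trans (Ordinal.natCast_lt_omega0 n))
  obtain ⟨e, he, hek⟩ := hc ⟨x, hx⟩ ⟨k, Nat.cast_lt.1 hi⟩
  exact ⟨⟨e, (hA _ e he).edge_mem⟩, hA _ e he, by simp [hek]⟩

theorem isLink_of_inc_of_inc {α β : Type*} {G : Graph α β} {e : β} {x y : α} (hx : G.Inc e x)
    (hy : G.Inc e y) (hxy : x ≠ y) : G.IsLink e x y := by
  obtain ⟨z, hz⟩ := hx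
  obtain rfl := hy.eq_of_isLink_of_ne_left hz hxy.symm
  exact hz

end Graph

/-- Gupta's theorem for arbitrary (possibly infinite) multigraphs without loops. -/
theorem theorem4p5 {α : Type*} {β : Type*} (G : Graph α β) (hG : G.Loopless)
    (n : ℕ) (hn : 1 ≤ n) (X : Set α) (hX : X ⊆ G.vertexSet)
    (hdeg : ∀ x ∈ X, (n : Cardinal) + G.multiplicity ≤ G.cardDegree x) :
    ∃ c : G.edgeSet →. Ordinal, G.IsGoodColoringOver (n : Cardinal) c X := by
  classical
  have : Nonempty (Fin n) := ⟨⟨0, hn⟩⟩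
  have htwo : ∀ A : X → Finset β, (∀ x, ∀ e ∈ A x, G.Inc e x) →
      SpareColoring.AtMostTwoEnds A := by
    intro A hA e x y z hx hy hz hxy hxz
    have h := Graph.isLink_of_inc_of_inc (hA x e hx) (hA y e hy) (fun h => hxy (Subtype.ext h))
    exact Subtype.ext ((hA z e hz).eq_of_isLink_of_ne_left h fun h => hxz (Subtype.ext h.symm)).symm
  rcases lt_or_ge G.multiplicity Cardinal.aleph0 with hμ | hμ
  · obtain ⟨μ, hμ⟩ := Cardinal.lt_aleph0.1 hμ
    have h : ∀ x : X, ∃ s : Finset β, s.card = n + μ ∧ ∀ e ∈ s, G.Inc e x := fun x =>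
      G.exists_finset_subset_incidenceSet <| by simpa [hμ] using hdeg x x.2
    choose A hcard hA using h
    refine G.exists_isGoodColoringOver hA (SpareColoring.exists_coloring (htwo A hA) (μ := μ) ?_
      fun x => by simp [hcard])
    intro x y hxy
    have hsub : ((A x ∩ A y : Finset β) : Set β) ⊆ G.edgesBetween x y := by
      intro e he
      obtain ⟨hx, hy⟩ := Finset.mem_inter.1 he
      exact Graph.isLink_of_inc_of_inc (hA x e hx) (hA y e hy) fun h => hxy (Subtype.ext h)
    have h1 := (Cardinal.mk_le_mk_of_subset hsub).trans
      (le_ciSup G.bddAbove_range_edgesBetween ((x : α), (y : α)))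
    change _ ≤ G.multiplicity at h1
    rw [hμ, Finset.coe_sort_coe, Cardinal.mk_coe_finset] at h1
    exact_mod_cast h1
  · -- If the multiplicity is infinite, then so are the degrees, and `2 * n` edges per vertex
    -- suffice.
    have h : ∀ x : X, ∃ s : Finset β, s.card = 2 * n ∧ ∀ e ∈ s, G.Inc e x := fun x =>
      G.exists_finset_subset_incidenceSet <| (Cardinal.natCast_le_aleph0).trans <|
        hμ.trans <| le_add_self.trans (hdeg x x.2)
    choose A hcard hA using h
    exact G.exists_isGoodColoringOver hA
      (SpareColoring.exists_coloring_of_two_mul_card_le (htwo A hA) fun x => by simp [hcard])
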